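/- Consider the word RAM: words of $w$ bits, registers and a memory addressed by words (all initially $0$ outside the input), and unit-cost instructions (constants, moves, arithmetic modulo $2^w$, integer division, bitwise operations, shifts, indirect loads and stores, jumps and comparisons). A string of length $n\ge 1$ over $[1..\sigma]$ is stored with one symbol per word, and $n$ and $\sigma$ are part of the input. A swap exchanges two contiguous symbols of a string, and the Swap edit distance from $S$ to $T$ is the least number of swaps transforming $S$ into $T$, or $\infty$ if there is no such sequence of swaps (that is, if $S$ and $T$ do not have the same number of occurrences of each symbol). Write $\lg=\log_2$. There are a program and constants $\kappa\in\mathbb{N}$ and $C>0$ such that, for all $n,\sigma\ge 1$, all strings $S,T\in[1..\sigma]^n$ and all word sizes $w\ge \kappa\lg(n+\sigma)$, the program halts on input $(S,T)$ and outputs the Swap edit distance $d$ from $S$ to $T$, in time at most $$C\cdot n\,\bigl(1+\max\{0,\lg(d/n)\}\bigr)\cdot\max\{1,\lg\lg\sigma\}$$ if $d<\infty$, and in time at most $C(n+\sigma)$ if $d=\infty$. Here $\max\{0,\lg(d/n)\}$ is $0$ for $d=0$, and $\max\{1,\lg\lg\sigma\}$ is $1$ for $\sigma=1$. -/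

import Mathlib

/-! ### Swap edit distance -/

/-- `S'` is obtained from the string `S` by exchanging two contiguous symbols. -/
def SwapStep {n : ℕ} {α : Type*} (S S' : Fin n → α) : Prop :=
  ∃ i j : Fin n, j.val = i.val + 1 ∧ S' = S ∘ Equiv.swap i j

/-- `SwapReach k S T`: some sequence of exactly `k` swaps transforms `S` into `T`. -/
inductive SwapReach {n : ℕ} {α : Type*} : ℕ → (Fin n → α) → (Fin n → α) → Prop
  | refl (S : Fin n → α) : SwapReach 0 S S
  | step {k : ℕ} {S T U : Fin n → α} (h : SwapReach k S T) (hs : SwapStep T U) :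
      SwapReach (k + 1) S U

/-- The swap edit distance: the least number of swaps transforming `S` into `T`, and `⊤` if no
sequence of swaps does. -/
noncomputable def swapEditDist {n : ℕ} {α : Type*} (S T : Fin n → α) : ℕ∞ :=
  ⨅ (k : ℕ) (_ : SwapReach k S T), (k : ℕ∞)

/-! ### The word RAM

Words of `w` bits are represented by the natural numbers below `2 ^ w`.  A machine has registers
and a memory whose cells are addressed by words; every instruction costs one unit of time. -/

namespace WordRAM

/-- Instructions; the arguments are register names, except for constants `c` and for jump
targets `l`. -/
inductive Instr
  | const (r c : ℕ)
  | move (r a : ℕ)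
  | add (r a b : ℕ)
  | sub (r a b : ℕ)
  | mul (r a b : ℕ)
  | div (r a b : ℕ)
  | and (r a b : ℕ)
  | or (r a b : ℕ)
  | xor (r a b : ℕ)
  | shl (r a b : ℕ)
  | shr (r a b : ℕ)
  | load (r a : ℕ)
  | store (a b : ℕ)
  | jump (l : ℕ)
  | jumpLt (a b l : ℕ)
  | jumpEq (a b l : ℕ)

structure State where
  pc : ℕ
  reg : ℕ → ℕ
  mem : ℕ → ℕ

/-- Write the word `v mod 2 ^ w` into register `r` and go to the next instruction. -/
def State.set (w : ℕ) (s : State) (r v : ℕ) : State :=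
  { s with pc := s.pc + 1, reg := Function.update s.reg r (v % 2 ^ w) }

/-- Effect of one instruction on a machine with words of `w` bits: arithmetic is modulo `2 ^ w`,
division rounds down (and gives `0` for the divisor `0`). -/
def Instr.exec (w : ℕ) (s : State) : Instr → State
  | const r c => s.set w r c
  | move r a => s.set w r (s.reg a)
  | add r a b => s.set w r (s.reg a + s.reg b)
  | sub r a b => s.set w r (s.reg a + 2 ^ w - s.reg b)
  | mul r a b => s.set w r (s.reg a * s.reg b)
  | div r a b => s.set w r (s.reg a / s.reg b)
  | and r a b => s.set w r (s.reg a &&& s.reg b)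
  | or r a b => s.set w r (s.reg a ||| s.reg b)
  | xor r a b => s.set w r (s.reg a ^^^ s.reg b)
  | shl r a b => s.set w r (s.reg a <<< s.reg b)
  | shr r a b => s.set w r (s.reg a >>> s.reg b)
  | load r a => s.set w r (s.mem (s.reg a))
  | store a b => { s with pc := s.pc + 1, mem := Function.update s.mem (s.reg a) (s.reg b) }
  | jump l => { s with pc := l }
  | jumpLt a b l => { s with pc := if s.reg a < s.reg b then l else s.pc + 1 }
  | jumpEq a b l => { s with pc := if s.reg a = s.reg b then l else s.pc + 1 }

/-- One step of the program `P`; nothing changes once the program counter has left `P`. -/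
def step (w : ℕ) (P : List Instr) (s : State) : State :=
  match P[s.pc]? with
  | none => s
  | some I => I.exec w s

/-- Started in `s`, the program `P` halts in `s'` after exactly `t` executed instructions.  It
halts when the program counter leaves the program. -/
def HaltsIn (w : ℕ) (P : List Instr) (s : State) (t : ℕ) (s' : State) : Prop :=
  (step w P)^[t] s = s' ∧ P.length ≤ s'.pc ∧ ∀ k < t, ((step w P)^[k] s).pc < P.length

/-- Input: `n` in register `0`, `σ` in register `1`, the symbols of `S` in the cells
`0, …, n - 1`, those of `T` in the cells `n, …, 2 n - 1`, and `0` everywhere else.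
The element `a` of `Fin σ` stands for the symbol `a + 1` of the alphabet `[1..σ]`. -/
def inputState {n σ : ℕ} (S T : Fin n → Fin σ) : State where
  pc := 0
  reg := fun r => if r = 0 then n else if r = 1 then σ else 0
  mem := fun a =>
    if h : a < n then (S ⟨a, h⟩).val + 1
    else if h : a - n < n then (T ⟨a - n, h⟩).val + 1
    else 0

/-- Output: `⊤` is reported by a `0` in register `0`, and the number `d` by a nonzero word in
register `0` and `d` in register `1`. -/
def State.output (s : State) : ℕ∞ := if s.reg 0 = 0 then ⊤ else (s.reg 1 : ℕ∞)

end WordRAM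

/-- `n (1 + lg (d / n)) lg lg σ`, where `lg (d / n)` is read as `0` if `d ≤ n`, and `lg lg σ` as
`1` if `σ ≤ 4`. -/
noncomputable def swapTimeBound (n σ d : ℕ) : ℝ :=
  n * (1 + max 0 (Real.logb 2 ((d : ℝ) / n))) * max 1 (Real.logb 2 (Real.logb 2 σ))

/-! Match the occurrences of each symbol in `S` with those in `T` in order. A swap changes the
number of inversions of this stable matching `f` by at most one, and bubble sort removes one per
swap, so the distance `d` is the inversion number (`swapEditDist_eq_card_inversions`). If no
matching exists, the linear matching phase detects it and the distance is infinite.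

Counting the inversions within the time bound rests on locality. Let `E` be the sum of the positive
displacements `f i - i`. It costs linear time and satisfies `E ≤ d`
(`sum_displacement_le_card_inversions`). Take the least `K` with `E ≤ n * 2 ^ K`; then `K ≤ 1 + max
0 (lg (d / n))`. The values `f 0, f 1, …` are entered into a counting tree cut off at height `K`.
Smaller values in the same block of length `2 ^ K` are counted by climbing `K` levels
(`localCount_succ`). Those in earlier blocks are counted by a finger that walks along the top level
and maintains a prefix sum.

The walk is short: `|f (i + 1) - f i|` is at most `1` plus the displacements at `i` and `i + 1`, and
all absolute displacements add up to `2 * E`, so the finger makes at most `6 * n` moves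
(`sum_fingerMove_le`). The total time is `O(n * (1 + K))`; the factor `max 1 (lg lg σ)` is only used
to be at least `1`. -/

/-! ### Inversions and the swap distance -/

/-- The pairs of positions that `f` puts in the wrong order. -/
def inversions {n : ℕ} (f : Fin n → Fin n) : Finset (Fin n × Fin n) :=
  {p | p.1 < p.2 ∧ f p.2 < f p.1}

lemma mem_inversions {n : ℕ} (f : Fin n → Fin n) (p q : Fin n) :
    (p, q) ∈ inversions f ↔ p < q ∧ f q < f p := by
  simp [inversions]

/-- `π` matches the occurrences of every symbol in `S` with those in `T` in order. -/
structure IsStableMatching {n : ℕ} {α : Type*} (S T : Fin n → α) (π : Equiv.Perm (Fin n)) :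
    Prop where
  comp : ∀ i, T (π i) = S i
  mono : ∀ i j, i < j → S i = S j → π i < π j

/-- No value lies strictly between two neighbours, so exchanging them affects no comparison except
their own. -/
lemma swap_adjacent_lt_iff {n : ℕ} {i j a b : Fin n} (hij : j.val = i.val + 1)
    (h₁ : ¬ (a = i ∧ b = j)) (h₂ : ¬ (a = j ∧ b = i)) :
    Equiv.swap i j a < Equiv.swap i j b ↔ a < b := by
  simp only [Equiv.swap_apply_def]
  simp only [Fin.ext_iff, Fin.lt_def] at *
  split_ifs <;> omega

lemma inversions_swap_adjacent_of_lt {n : ℕ} {i j : Fin n} (hij : j.val = i.val + 1)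
    (π : Equiv.Perm (Fin n)) (h : π.symm i < π.symm j) :
    inversions (π.trans (Equiv.swap i j)) = insert (π.symm i, π.symm j) (inversions π) := by
  ext ⟨p, q⟩
  have hne : i ≠ j := by rintro rfl; omega
  simp only [mem_inversions, Finset.mem_insert, Prod.mk.injEq, Equiv.trans_apply,
    Equiv.eq_symm_apply]
  by_cases h₁ : π q = i ∧ π p = j
  · obtain ⟨rfl, hp⟩ := h₁
    subst hp
    simp only [Equiv.symm_apply_apply] at h
    simp [h.not_gt, hne.symm]
  by_cases h₂ : π q = j ∧ π p = i
  · obtain ⟨rfl, hp⟩ := h₂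
    subst hp
    simp only [Equiv.symm_apply_apply] at h
    simp only [h, Equiv.swap_apply_left, Equiv.swap_apply_right, true_and, and_self, true_or,
      iff_true]
    simp only [Fin.lt_def]; omega
  · rw [swap_adjacent_lt_iff hij h₁ h₂]
    have : ¬ (π p = i ∧ π q = j) := fun h => h₂ ⟨h.2, h.1⟩
    simp [this]

lemma card_inversions_swap_adjacent_of_lt {n : ℕ} {i j : Fin n} (hij : j.val = i.val + 1)
    (π : Equiv.Perm (Fin n)) (h : π.symm i < π.symm j) :
    (inversions (π.trans (Equiv.swap i j))).card = (inversions π).card + 1 := by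
  rw [inversions_swap_adjacent_of_lt hij π h, Finset.card_insert_of_notMem]
  simp only [mem_inversions, Equiv.apply_symm_apply, Fin.lt_def]
  omega

lemma card_inversions_swap_adjacent_of_gt {n : ℕ} {i j : Fin n} (hij : j.val = i.val + 1)
    (π : Equiv.Perm (Fin n)) (h : π.symm j < π.symm i) :
    (inversions π).card = (inversions (π.trans (Equiv.swap i j))).card + 1 := by
  have := card_inversions_swap_adjacent_of_lt hij (π.trans (Equiv.swap i j)) (by simpa using h)
  have e : (π.trans (Equiv.swap i j)).trans (Equiv.swap i j) = π := by ext; simp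
  rwa [e] at this

/-- This is the lower bound on the distance. A swap of equal symbols leaves the string, hence the
matching, unchanged. A swap of different symbols is composed with the matching: equal symbols keep
their order, and one inversion appears or disappears. -/
lemma SwapReach.exists_stableMatching {n : ℕ} {α : Type*} {k : ℕ} {S T : Fin n → α}
    (h : SwapReach k S T) : ∃ π, IsStableMatching S T π ∧ (inversions π).card ≤ k := by
  induction h with
  | refl S =>
    refine ⟨Equiv.refl _, ⟨fun _ => rfl, fun _ _ h _ => h⟩, ?_⟩
    rw [Nat.le_zero, Finset.card_eq_zero, Finset.eq_empty_iff_forall_notMem]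
    rintro ⟨p, q⟩ hpq
    rw [mem_inversions] at hpq
    exact hpq.1.not_gt hpq.2
  | @step k S T U _ hs ih =>
    obtain ⟨π, hπ, hk⟩ := ih
    obtain ⟨i, j, hij, rfl⟩ := hs
    by_cases hT : T i = T j
    · refine ⟨π, ⟨fun p => ?_, hπ.mono⟩, by omega⟩
      rw [← hπ.comp, Function.comp_apply, Equiv.swap_apply_def]
      split_ifs with h₁ h₂
      · rw [h₁, hT]
      · rw [h₂, hT]
      · rfl
    · refine ⟨π.trans (Equiv.swap i j), ⟨fun p => ?_, fun p q hpq hS => ?_⟩, ?_⟩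
      · simp [hπ.comp]
      · simp only [Equiv.trans_apply]
        have hTpq : T (π p) = T (π q) := by rw [hπ.comp, hπ.comp, hS]
        rw [swap_adjacent_lt_iff hij]
        · exact hπ.mono p q hpq hS
        · rintro ⟨rfl, rfl⟩; exact hT hTpq
        · rintro ⟨rfl, rfl⟩; exact hT hTpq.symm
      · have hne : i ≠ j := by rintro rfl; omega
        rcases lt_or_gt_of_ne (π.symm.injective.ne hne) with h | h
        · rw [card_inversions_swap_adjacent_of_lt hij π h]; omega
        · have := card_inversions_swap_adjacent_of_gt hij π h; omega

/-- At the first position `i` of disagreement, say with `π i < ρ i`, the position that `ρ` sends to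
`π i` carries the symbol of `i`. It cannot precede `i` by injectivity of `π`, nor follow it by
monotonicity of `ρ`. -/
lemma IsStableMatching.unique {n : ℕ} {α : Type*} {S T : Fin n → α} {π ρ : Equiv.Perm (Fin n)}
    (hπ : IsStableMatching S T π) (hρ : IsStableMatching S T ρ) : π = ρ := by
  have key : ∀ {π ρ : Equiv.Perm (Fin n)}, IsStableMatching S T π → IsStableMatching S T ρ →
      ∀ i, (∀ j < i, π j = ρ j) → ¬ π i < ρ i := by
    intro π ρ hπ hρ i ih hlt
    obtain ⟨k, hk⟩ := ρ.surjective (π i)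
    have hS : S k = S i := by rw [← hρ.comp, hk, hπ.comp]
    rcases lt_trichotomy k i with h | h | h
    · have := ih k h
      rw [hk] at this
      exact h.ne (π.injective this)
    · subst h; exact hlt.ne hk.symm
    · have := hρ.mono i k h hS.symm
      rw [hk] at this
      exact this.not_gt hlt
  ext i : 1
  induction i using WellFoundedLT.induction with
  | _ i ih =>
    exact le_antisymm (not_lt.1 (key hρ hπ i fun j hj => (ih j hj).symm))
      (not_lt.1 (key hπ hρ i ih))

lemma exists_adjacent_descent {n : ℕ} (π : Equiv.Perm (Fin n)) (h : inversions π ≠ ∅) :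
    ∃ i j : Fin n, j.val = i.val + 1 ∧ π.symm j < π.symm i := by
  by_contra! hc
  have hmono : ∀ d : ℕ, ∀ i j : Fin n, j.val = i.val + d → π.symm i ≤ π.symm j := by
    intro d
    induction d with
    | zero => intro i j hij; rw [Fin.ext (a := j) (b := i) (by omega)]
    | succ d ih =>
      intro i j hij
      exact (ih i ⟨i.val + d, by omega⟩ rfl).trans (hc ⟨i.val + d, by omega⟩ j (by simp; omega))
  obtain ⟨⟨p, q⟩, hpq⟩ := Finset.nonempty_iff_ne_empty.2 h
  rw [mem_inversions] at hpq
  have := hmono ((π p).val - (π q).val) (π q) (π p) (by have := hpq.2; rw [Fin.lt_def] at this; omega)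
  simp only [Equiv.symm_apply_apply] at this
  exact this.not_gt hpq.1

/-- Bubble sort: exchanging an adjacent descent of `π.symm` removes exactly one inversion, and only
the identity has none. -/
lemma swapReach_card_inversions {n : ℕ} {α : Type*} (π : Equiv.Perm (Fin n)) (S T : Fin n → α)
    (h : ∀ i, T (π i) = S i) : SwapReach (inversions π).card S T := by
  induction hk : (inversions π).card generalizing π T with
  | zero =>
    -- The identity is the only order automorphism of `Fin n`.
    have hsymm : ∀ ρ : Equiv.Perm (Fin n), StrictMono ρ → ρ = Equiv.refl _ := fun ρ hρ => by
      ext i : 1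
      have := Subsingleton.elim (StrictMono.orderIsoOfSurjective ρ hρ ρ.surjective)
        (OrderIso.refl (Fin n))
      exact congrArg (fun e : Fin n ≃o Fin n => e i) this
    have hπ : π = Equiv.refl _ := hsymm π fun p q hpq => by
      by_contra hlt
      have hlt : π q < π p := lt_of_le_of_ne (not_lt.1 hlt) (π.injective.ne hpq.ne')
      rw [Finset.card_eq_zero] at hk
      exact Finset.notMem_empty (p, q) (hk ▸ (mem_inversions _ _ _).2 ⟨hpq, hlt⟩)
    subst hπ
    have : S = T := funext fun i => (h i).symm
    subst this
    exact .refl S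
  | succ k ih =>
    obtain ⟨i, j, hij, hlt⟩ := exists_adjacent_descent π (by
      rintro h; simp [h] at hk)
    have hc := card_inversions_swap_adjacent_of_gt hij π hlt
    refine .step (ih (π.trans (Equiv.swap i j)) (T ∘ Equiv.swap i j) (fun p => by simp [h])
      (by omega)) ⟨i, j, hij, ?_⟩
    ext p; simp

lemma swapEditDist_eq_card_inversions {n : ℕ} {α : Type*} {S T : Fin n → α}
    {π : Equiv.Perm (Fin n)} (hπ : IsStableMatching S T π) :
    swapEditDist S T = ((inversions π).card : ℕ∞) := by
  refine le_antisymm (iInf₂_le (f := fun k (_ : SwapReach k S T) => (k : ℕ∞)) _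
    (swapReach_card_inversions π S T hπ.comp)) (le_iInf₂ fun k hk => ?_)
  obtain ⟨ρ, hρ, hle⟩ := hk.exists_stableMatching
  rw [hπ.unique hρ]
  exact_mod_cast hle

lemma swapEditDist_eq_top {n : ℕ} {α : Type*} {S T : Fin n → α}
    (h : ∀ π : Equiv.Perm (Fin n), ¬ ∀ i, T (π i) = S i) : swapEditDist S T = ⊤ := by
  refine iInf₂_eq_top.2 fun k hk => ?_
  obtain ⟨ρ, hρ, -⟩ := hk.exists_stableMatching
  exact absurd hρ.comp (h ρ)

/-! ### Displacements and inversions -/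

lemma card_filter_lt_perm {n : ℕ} (π : Equiv.Perm (Fin n)) (i : Fin n) :
    ({j | π j < π i} : Finset (Fin n)).card = (π i).val := by
  rw [← Fin.card_Iio (π i)]
  refine Finset.card_bij (fun j _ => π j) (by simp) (fun _ _ _ _ h => π.injective h)
    fun k hk => ⟨π.symm k, by simpa using hk, by simp⟩

/-- Exactly `π i` positions have a value below `π i`, and at most `i` of them precede `i`. The
remaining ones, at least `π i - i`, form inversions with `i`. -/
lemma sum_displacement_le_card_inversions {n : ℕ} (π : Equiv.Perm (Fin n)) :
    ∑ i, ((π i).val - i.val) ≤ (inversions π).card := by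
  have hcard : (inversions π).card = ∑ i, ({j | i < j ∧ π j < π i} : Finset (Fin n)).card := by
    rw [Finset.card_eq_sum_card_fiberwise (f := Prod.fst) (t := Finset.univ) (by simp)]
    refine Finset.sum_congr rfl fun i _ => ?_
    refine Finset.card_bij (fun p _ => p.2) ?_ ?_ ?_
    · rintro ⟨p, q⟩ h
      simp only [Finset.mem_filter, mem_inversions] at h
      obtain ⟨h, rfl⟩ := h
      simpa using h
    · rintro ⟨p, q⟩ h ⟨p', q'⟩ h' heq
      simp only [Finset.mem_filter] at h h'
      ext <;> simp_all
    · intro j hj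
      exact ⟨(i, j), by simpa [mem_inversions] using hj, rfl⟩
  rw [hcard]
  refine Finset.sum_le_sum fun i _ => ?_
  have h₁ := card_filter_lt_perm π i
  have h₂ : ({j | π j < π i} : Finset (Fin n)) ⊆ ({j | i < j ∧ π j < π i} : Finset (Fin n)) ∪ Finset.Iio i := by
    intro j hj
    simp only [Finset.mem_filter, Finset.mem_univ, true_and, Finset.mem_union,
      Finset.mem_Iio] at hj ⊢
    rcases lt_trichotomy i j with h | rfl | h
    · exact .inl ⟨h, hj⟩
    · exact absurd hj (lt_irrefl _)
    · exact .inr h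
  have h₃ := (Finset.card_le_card h₂).trans (Finset.card_union_le _ _)
  rw [h₁, Fin.card_Iio] at h₃
  omega

/-- Number of inversions, counted at their right end, in the first `i` values of `f`. -/
def inversionSum (f : ℕ → ℕ) (i : ℕ) : ℕ :=
  ∑ j ∈ Finset.range i, ((Finset.range j).filter fun k => f j < f k).card

lemma card_inversions_eq_inversionSum {n : ℕ} (π : Equiv.Perm (Fin n)) (f : ℕ → ℕ)
    (hf : ∀ i : Fin n, f i = π i) : (inversions π).card = inversionSum f n := by
  rw [inversionSum, Finset.card_eq_sum_card_fiberwise (f := fun p => p.2) (t := Finset.univ)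
    (by simp), Finset.sum_range]
  refine Finset.sum_congr rfl fun j _ => ?_
  refine Finset.card_bij (fun p _ => p.1.val) ?_ ?_ ?_
  · rintro ⟨p, q⟩ h
    simp only [Finset.mem_filter, mem_inversions] at h
    obtain ⟨h, rfl⟩ := h
    simpa [hf] using h
  · rintro ⟨p, q⟩ h ⟨p', q'⟩ h' heq
    simp only [Finset.mem_filter] at h h'
    ext <;> simp_all
  · intro k hk
    simp only [Finset.mem_filter, Finset.mem_range] at hk
    refine ⟨(⟨k, by omega⟩, j), ?_, rfl⟩
    have h := hf ⟨k, by omega⟩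
    simp only at h
    rw [hf, h] at hk
    simp only [Finset.mem_filter, mem_inversions, and_true]
    exact hk

namespace WordRAM

/-! ### Running programs -/

/-- Started in `s` at time `c`, the program `P` reaches some state `s'` at a time `c'` with
`Q c' s'`, and it does not halt before. -/
def Leads (w : ℕ) (P : List Instr) (c : ℕ) (s : State) (Q : ℕ → State → Prop) : Prop :=
  ∃ t, Q (c + t) ((step w P)^[t] s) ∧ ∀ k < t, ((step w P)^[k] s).pc < P.length

/-- The register file whose first registers are listed in `l`, all others being `0`. -/
def regs (l : List ℕ) : ℕ → ℕ := fun r => l.getD r 0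

namespace Leads

variable {w : ℕ} {P : List Instr} {c pc : ℕ} {l : List ℕ} {mem : ℕ → ℕ} {Q : ℕ → State → Prop}

lemma done {s : State} (h : Q c s) : Leads w P c s Q := ⟨0, h, by simp⟩

/-- Source of the instruction rules below, which execute the program symbolically in continuation
style. Their side conditions exclude overflow, so registers hold exact values. -/
lemma of_step {s : State} {I : Instr} (hI : P[s.pc]? = some I)
    (h : Leads w P (c + 1) (I.exec w s) Q) : Leads w P c s Q := by
  obtain ⟨t, hQ, hpc⟩ := h
  have hs : step w P s = I.exec w s := by simp [step, hI]
  refine ⟨t + 1, ?_, ?_⟩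
  · rw [Function.iterate_succ_apply, hs, show c + (t + 1) = c + 1 + t by omega]
    exact hQ
  · rintro (_ | k) hk
    · exact (List.getElem?_eq_some_iff.1 hI).1
    · rw [Function.iterate_succ_apply, hs]
      exact hpc k (by omega)

lemma regs_set {r v : ℕ} (hr : r < l.length) :
    Function.update (regs l) r v = regs (l.set r v) := by
  ext a
  by_cases h : a = r
  · subst h; simp [regs, hr]
  · rw [Function.update_of_ne h]
    simp [regs, List.getElem?_set_ne (Ne.symm h)]

lemma of_set {I : Instr} {r v v' : ℕ} (hI : P[pc]? = some I)
    (he : I.exec w ⟨pc, regs l, mem⟩ = State.set w ⟨pc, regs l, mem⟩ r v')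
    (hv' : v' % 2 ^ w = v) (hr : r < l.length)
    (h : Leads w P (c + 1) ⟨pc + 1, regs (l.set r v), mem⟩ Q) :
    Leads w P c ⟨pc, regs l, mem⟩ Q := by
  refine of_step hI ?_
  rw [he, State.set, hv', regs_set hr]
  exact h

lemma const {r x : ℕ} (hI : P[pc]? = some (.const r x)) (hr : r < l.length) (hx : x < 2 ^ w)
    (h : Leads w P (c + 1) ⟨pc + 1, regs (l.set r x), mem⟩ Q) :
    Leads w P c ⟨pc, regs l, mem⟩ Q :=
  of_set hI rfl (Nat.mod_eq_of_lt hx) hr h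

lemma move {r a : ℕ} (hI : P[pc]? = some (.move r a)) (hr : r < l.length)
    (hx : l.getD a 0 < 2 ^ w)
    (h : Leads w P (c + 1) ⟨pc + 1, regs (l.set r (l.getD a 0)), mem⟩ Q) :
    Leads w P c ⟨pc, regs l, mem⟩ Q :=
  of_set hI rfl (Nat.mod_eq_of_lt hx) hr h

lemma add {r a b : ℕ} (hI : P[pc]? = some (.add r a b)) (hr : r < l.length)
    (hx : l.getD a 0 + l.getD b 0 < 2 ^ w)
    (h : Leads w P (c + 1) ⟨pc + 1, regs (l.set r (l.getD a 0 + l.getD b 0)), mem⟩ Q) :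
    Leads w P c ⟨pc, regs l, mem⟩ Q :=
  of_set hI rfl (Nat.mod_eq_of_lt hx) hr h

lemma sub {r a b : ℕ} (hI : P[pc]? = some (.sub r a b)) (hr : r < l.length)
    (hx : l.getD a 0 < 2 ^ w) (hb : l.getD b 0 ≤ l.getD a 0)
    (h : Leads w P (c + 1) ⟨pc + 1, regs (l.set r (l.getD a 0 - l.getD b 0)), mem⟩ Q) :
    Leads w P c ⟨pc, regs l, mem⟩ Q := by
  refine of_set hI rfl ?_ hr h
  change (l.getD a 0 + 2 ^ w - l.getD b 0) % 2 ^ w = _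
  rw [Nat.sub_add_comm hb, Nat.add_mod_right, Nat.mod_eq_of_lt (by omega)]

lemma and_one {r a b : ℕ} (hI : P[pc]? = some (.and r a b)) (hr : r < l.length)
    (hw : 0 < w) (hb : l.getD b 0 = 1)
    (h : Leads w P (c + 1) ⟨pc + 1, regs (l.set r (l.getD a 0 % 2)), mem⟩ Q) :
    Leads w P c ⟨pc, regs l, mem⟩ Q := by
  refine of_set hI rfl ?_ hr h
  change (l.getD a 0 &&& l.getD b 0) % 2 ^ w = _
  rw [hb, Nat.and_one_is_mod]
  have : 2 ^ 1 ≤ 2 ^ w := Nat.pow_le_pow_right (by norm_num) hw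
  exact Nat.mod_eq_of_lt (by omega)

lemma shr_one {r a b : ℕ} (hI : P[pc]? = some (.shr r a b)) (hr : r < l.length)
    (hx : l.getD a 0 < 2 ^ w) (hb : l.getD b 0 = 1)
    (h : Leads w P (c + 1) ⟨pc + 1, regs (l.set r (l.getD a 0 / 2)), mem⟩ Q) :
    Leads w P c ⟨pc, regs l, mem⟩ Q := by
  refine of_set hI rfl ?_ hr h
  change (l.getD a 0 >>> l.getD b 0) % 2 ^ w = _
  rw [hb, Nat.shiftRight_one]
  exact Nat.mod_eq_of_lt (by omega)

lemma load {r a : ℕ} (v : ℕ) (hI : P[pc]? = some (.load r a)) (hr : r < l.length)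
    (hv : mem (l.getD a 0) = v) (hx : v < 2 ^ w)
    (h : Leads w P (c + 1) ⟨pc + 1, regs (l.set r v), mem⟩ Q) :
    Leads w P c ⟨pc, regs l, mem⟩ Q :=
  of_set hI rfl (by rw [← Nat.mod_eq_of_lt hx, ← hv]; rfl) hr h

lemma store {a b : ℕ} (hI : P[pc]? = some (.store a b))
    (h : Leads w P (c + 1)
      ⟨pc + 1, regs l, Function.update mem (l.getD a 0) (l.getD b 0)⟩ Q) :
    Leads w P c ⟨pc, regs l, mem⟩ Q :=
  of_step hI h

lemma jump {t : ℕ} (hI : P[pc]? = some (.jump t))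
    (h : Leads w P (c + 1) ⟨t, regs l, mem⟩ Q) : Leads w P c ⟨pc, regs l, mem⟩ Q :=
  of_step hI h

lemma jumpLt_pos {a b t : ℕ} (hI : P[pc]? = some (.jumpLt a b t))
    (hab : l.getD a 0 < l.getD b 0)
    (h : Leads w P (c + 1) ⟨t, regs l, mem⟩ Q) : Leads w P c ⟨pc, regs l, mem⟩ Q := by
  refine of_step hI ?_
  simp only [Instr.exec]
  rwa [if_pos (by exact hab)]

lemma jumpLt_neg {a b t : ℕ} (hI : P[pc]? = some (.jumpLt a b t))
    (hab : l.getD b 0 ≤ l.getD a 0)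
    (h : Leads w P (c + 1) ⟨pc + 1, regs l, mem⟩ Q) : Leads w P c ⟨pc, regs l, mem⟩ Q := by
  refine of_step hI ?_
  simp only [Instr.exec]
  rwa [if_neg (by exact hab.not_gt)]

lemma jumpEq_pos {a b t : ℕ} (hI : P[pc]? = some (.jumpEq a b t))
    (hab : l.getD a 0 = l.getD b 0)
    (h : Leads w P (c + 1) ⟨t, regs l, mem⟩ Q) : Leads w P c ⟨pc, regs l, mem⟩ Q := by
  refine of_step hI ?_
  simp only [Instr.exec]
  rwa [if_pos (by exact hab)]

lemma jumpEq_neg {a b t : ℕ} (hI : P[pc]? = some (.jumpEq a b t))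
    (hab : l.getD a 0 ≠ l.getD b 0)
    (h : Leads w P (c + 1) ⟨pc + 1, regs l, mem⟩ Q) : Leads w P c ⟨pc, regs l, mem⟩ Q := by
  refine of_step hI ?_
  simp only [Instr.exec]
  rwa [if_neg (by exact hab)]

end Leads

/-- The program uses registers `0` to `17` only; an explicit list of them lets register accesses be
computed. -/
lemma inputState_eq {n σ : ℕ} (S T : Fin n → Fin σ) :
    inputState S T = ⟨0, regs [n, σ, 0, 0, 0, 0, 0, 0, 0, 0, 0, 0, 0, 0, 0, 0, 0, 0],
      (inputState S T).mem⟩ := by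
  simp only [inputState, State.mk.injEq, true_and, and_true]
  funext r
  rcases r with _ | _ | r
  · rfl
  · rfl
  · rw [if_neg (by omega), if_neg (by omega)]
    by_cases h : r < 16
    · interval_cases r <;> rfl
    · simp only [regs, List.getD_cons_succ]
      exact (List.getD_eq_default _ _ (by simp; omega)).symm

/-! ### The program -/

/-- Counts the inversions of the stable matching of two strings.  Register `2` holds `1`,
register `3` holds `0`. -/
def swapProgram : List Instr :=
  [ .const 2 1,
    .add 4 0 0,
    .move 5 0,
    -- 3: for `j = n - 1, …, 0`, prepend `j` to the list of the occurrences of its symbol in `T`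
    .jumpEq 5 3 13,
    .sub 5 5 2,
    .add 6 0 5,
    .load 7 6,
    .add 7 7 4,
    .load 8 7,
    .store 6 8,
    .add 8 5 2,
    .store 7 8,
    .jump 3,
    -- 13: for `i = 0, …, n - 1`, match the symbol `i` of `S` with the head of its list
    .jumpEq 5 0 28,
    .load 6 5,
    .add 6 6 4,
    .load 7 6,
    .jumpEq 7 3 81,
    .sub 7 7 2,
    .add 8 7 0,
    .load 8 8,
    .store 6 8,
    .store 5 7,
    .jumpLt 7 5 26,
    .sub 6 7 5,
    .add 9 9 6,
    .add 5 5 2,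
    .jump 13,
    -- 28: choose the number of levels of the tree
    .move 6 0,
    .jumpLt 6 9 31,
    .jump 34,
    .add 6 6 6,
    .add 10 10 2,
    .jump 29,
    -- 34: the main loop over the positions in `S`
    .add 11 4 1,
    .add 11 11 2,
    .const 5 0,
    .jumpEq 5 0 78,
    .load 6 5,
    .move 7 11,
    .move 8 10,
    .const 15 0,
    -- 42: go up the levels of the tree
    .jumpEq 8 3 56,
    .add 16 7 6,
    .and 17 6 2,
    .jumpEq 17 3 49,
    .sub 17 16 2,
    .load 17 17,
    .add 15 15 17,
    .load 17 16,
    .add 17 17 2,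
    .store 16 17,
    .shr 6 6 2,
    .add 7 7 0,
    .sub 8 8 2,
    .jump 42,
    -- 56: move the finger on the top level
    .jumpLt 12 6 59,
    .jumpLt 6 12 64,
    .jump 69,
    .add 17 7 12,
    .load 17 17,
    .add 13 13 17,
    .add 12 12 2,
    .jump 56,
    .sub 12 12 2,
    .add 17 7 12,
    .load 17 17,
    .sub 13 13 17,
    .jump 56,
    -- 69: count the inversions
    .add 16 7 6,
    .load 17 16,
    .add 17 17 2,
    .store 16 17,
    .add 14 14 5,
    .sub 14 14 13,
    .sub 14 14 15,
    .add 5 5 2,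
    .jump 37,
    .move 1 14,
    .const 0 1,
    .jump 82,
    .const 0 0 ]

/-! ### Matching the occurrences -/

/-- `x = q + 1` for the first position `q ≥ p` of the symbol `a` in `t`, or `x = 0` if there is
no such position. -/
def IsFirst (t : ℕ → ℕ) (n p a x : ℕ) : Prop :=
  (x = 0 ∧ ∀ q, p ≤ q → q < n → t q ≠ a) ∨
    ∃ q, x = q + 1 ∧ p ≤ q ∧ q < n ∧ t q = a ∧ ∀ q', p ≤ q' → q' < q → t q' ≠ a

lemma IsFirst.le {t : ℕ → ℕ} {n p a x : ℕ} (h : IsFirst t n p a x) : x ≤ n := by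
  rcases h with ⟨rfl, -⟩ | ⟨q, rfl, -, h, -⟩ <;> omega

lemma IsFirst.pred {t : ℕ → ℕ} {n p a x : ℕ} (h : IsFirst t n (p + 1) a x) (hp : t p ≠ a) :
    IsFirst t n p a x := by
  have key : ∀ q, p ≤ q → (p + 1 ≤ q → t q ≠ a) → t q ≠ a := fun q h₁ h₂ => by
    rcases h₁.eq_or_lt with rfl | h₁
    exacts [hp, h₂ h₁]
  rcases h with ⟨rfl, h⟩ | ⟨q, rfl, h₁, h₂, h₃, h₄⟩
  · exact .inl ⟨rfl, fun q hq hn => key q hq fun h' => h q h' hn⟩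
  · exact .inr ⟨q, rfl, by omega, h₂, h₃, fun q' hq' hlt => key q' hq' fun h' => h₄ q' h' hlt⟩

lemma isFirst_self {t : ℕ → ℕ} {n p : ℕ} (hp : p < n) : IsFirst t n p (t p) (p + 1) :=
  .inr ⟨p, rfl, le_rfl, hp, rfl, fun _ _ _ => by omega⟩

/-- The memory after the positions `j, …, n - 1` of `t` have been prepended to the lists of the
occurrences of their symbols. -/
structure ListInv (n σ : ℕ) (s t : ℕ → ℕ) (j : ℕ) (mem : ℕ → ℕ) : Prop where
  source : ∀ i < n, mem i = s i
  target : ∀ q < j, mem (n + q) = t q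
  next : ∀ q, j ≤ q → q < n → IsFirst t n (q + 1) (t q) (mem (n + q))
  head : ∀ a, 1 ≤ a → a ≤ σ → IsFirst t n j a (mem (n + n + a))
  zero : ∀ x, n + n + σ < x → mem x = 0

/-- The old head for `t j` becomes the successor of `j`, stored over the symbol itself, which is no
longer needed. For other symbols the first occurrence does not change. -/
lemma ListInv.succ {n σ : ℕ} {s t : ℕ → ℕ} {j : ℕ} {mem : ℕ → ℕ}
    (h : ListInv n σ s t (j + 1) mem) (hj : j < n) (h₁ : 1 ≤ t j) (hσ : t j ≤ σ) :
    ListInv n σ s t j (Function.update (Function.update mem (n + j) (mem (n + n + t j)))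
      (n + n + t j) (j + 1)) := by
  have hne : ∀ x, x ≠ n + n + t j → x ≠ n + j →
      Function.update (Function.update mem (n + j) (mem (n + n + t j)))
        (n + n + t j) (j + 1) x = mem x := fun x h h' => by
    rw [Function.update_of_ne h, Function.update_of_ne h']
  refine ⟨fun i hi => ?_, fun q hq => ?_, fun q hq hn => ?_, fun a h₁ ha => ?_, fun x hx => ?_⟩
  · rw [hne _ (by omega) (by omega), h.source i hi]
  · rw [hne _ (by omega) (by omega), h.target q (by omega)]
  · rcases hq.eq_or_lt with rfl | hq
    · rw [Function.update_of_ne (by omega), Function.update_self]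
      exact h.head _ h₁ hσ
    · rw [hne _ (by omega) (by omega)]
      exact h.next q hq hn
  · by_cases haj : a = t j
    · subst haj
      rw [Function.update_self]
      exact isFirst_self hj
    · rw [hne _ (by omega) (by omega)]
      exact (h.head a h₁ ha).pred (Ne.symm haj)
  · rw [hne _ (by omega) (by omega), h.zero x hx]

lemma leads_lists {w n σ : ℕ} {s t : ℕ → ℕ} {Q : ℕ → State → Prop}
    (ht : ∀ q < n, 1 ≤ t q ∧ t q ≤ σ) (hw : n + n + σ + 1 < 2 ^ w) (j : ℕ) (hj : j ≤ n)
    (c x₆ x₇ x₈ : ℕ) (mem : ℕ → ℕ) (hmem : ListInv n σ s t j mem)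
    (h : ∀ c' x₆ x₇ x₈ mem', c' ≤ c + 10 * j + 1 → ListInv n σ s t 0 mem' →
      Leads w swapProgram c'
        ⟨13, regs [n, σ, 1, 0, n + n, 0, x₆, x₇, x₈, 0, 0, 0, 0, 0, 0, 0, 0, 0], mem'⟩ Q) :
    Leads w swapProgram c
      ⟨3, regs [n, σ, 1, 0, n + n, j, x₆, x₇, x₈, 0, 0, 0, 0, 0, 0, 0, 0, 0], mem⟩ Q := by
  induction j generalizing c x₆ x₇ x₈ mem with
  | zero => exact .jumpEq_pos rfl rfl (h _ _ _ _ _ (by omega) hmem)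
  | succ j ih =>
    obtain ⟨h₁, hσ⟩ := ht j (by omega)
    have hx := (hmem.head _ h₁ hσ).le
    rw [add_comm (n + n)] at hx
    refine .jumpEq_neg rfl (Nat.succ_ne_zero j) ?_
    refine .sub rfl (by simp) (by simp; omega) (by simp) ?_
    refine .add rfl (by simp) (by simp; omega) ?_
    refine .load (t j) rfl (by simp) (by simpa using hmem.target j (by omega)) (by omega) ?_
    refine .add rfl (by simp) (by simp; omega) ?_
    refine .load (mem (t j + (n + n))) rfl (by simp) (by simp) (by omega) ?_
    refine .store rfl ?_
    refine .add rfl (by simp) (by simp; omega) ?_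
    refine .store rfl ?_
    refine .jump rfl ?_
    have := ih (by omega) (c + 1 + 1 + 1 + 1 + 1 + 1 + 1 + 1 + 1 + 1) (n + j) (t j + (n + n))
      (j + 1) _ (hmem.succ (by omega) h₁ hσ)
      fun c' x₆ x₇ x₈ mem' hc => h c' x₆ x₇ x₈ mem' (by omega)
    rw [add_comm (n + n) (t j)] at this
    simpa using this

/-- The memory after the first `i` symbols of `s` have been matched. -/
structure MatchInv (n σ : ℕ) (s t : ℕ → ℕ) (i : ℕ) (mem p : ℕ → ℕ) : Prop where
  lt : ∀ k < i, mem k < n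
  comp : ∀ k < i, t (mem k) = s k
  mono : ∀ k < i, ∀ l < k, s l = s k → mem l < mem k
  source : ∀ k, i ≤ k → k < n → mem k = s k
  next : ∀ q < n, IsFirst t n (q + 1) (t q) (mem (n + q))
  head : ∀ a, 1 ≤ a → a ≤ σ → IsFirst t n (p a) a (mem (n + n + a))
  zero : ∀ x, n + n + σ < x → mem x = 0
  lt_ptr : ∀ k < i, mem k < p (s k)
  used : ∀ a, ∀ q < p a, t q = a → q < n → ∃ k < i, mem k = q

lemma ListInv.matchInv {n σ : ℕ} {s t mem : ℕ → ℕ} (h : ListInv n σ s t 0 mem) :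
    MatchInv n σ s t 0 mem 0 where
  lt := by simp
  comp := by simp
  mono := by simp
  source k _ hk := h.source k hk
  next q hq := h.next q q.zero_le hq
  head := h.head
  zero := h.zero
  lt_ptr := by simp
  used := by simp

/-- The pointer `p a`, which is not stored by the program, stands just behind the last matched
occurrence of `a` in `t`. The list head is the first occurrence from there on: taking it preserves
the order and skips no occurrence. -/
lemma MatchInv.succ {n σ : ℕ} {s t : ℕ → ℕ} {i v : ℕ} {mem p : ℕ → ℕ}
    (h : MatchInv n σ s t i mem p) (hi : i < n) (h₁ : 1 ≤ s i) (hσ : s i ≤ σ)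
    (hv : mem (n + n + s i) = v + 1) :
    MatchInv n σ s t (i + 1)
      (Function.update (Function.update mem (n + n + s i) (mem (n + v))) i v)
      (Function.update p (s i) (v + 1)) := by
  obtain ⟨h0, -⟩ | ⟨q, hq, hpv, hvn, hts, hfirst⟩ := h.head _ h₁ hσ
  · omega
  obtain rfl : v = q := by omega
  have hne : ∀ x, x ≠ n + n + s i → x ≠ i →
      Function.update (Function.update mem (n + n + s i) (mem (n + v))) i v x = mem x :=
    fun x h h' => by rw [Function.update_of_ne h', Function.update_of_ne h]
  refine ⟨fun k hk => ?_, fun k hk => ?_, fun k hk l hl hs => ?_, fun k hk hkn => ?_,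
    fun q hq => ?_, fun a h₁ ha => ?_, fun x hx => ?_, fun k hk => ?_, fun a q hq hta hqn => ?_⟩
  · rcases (Nat.lt_succ_iff.1 hk).eq_or_lt with rfl | hk
    · simpa using hvn
    · rw [hne _ (by omega) (by omega)]; exact h.lt k hk
  · rcases (Nat.lt_succ_iff.1 hk).eq_or_lt with rfl | hk
    · simpa using hts
    · rw [hne _ (by omega) (by omega)]; exact h.comp k hk
  · rw [hne l (by omega) (by omega)]
    rcases (Nat.lt_succ_iff.1 hk).eq_or_lt with rfl | hk
    · rw [Function.update_self]
      have := h.lt_ptr l hl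
      rw [hs] at this
      omega
    · rw [hne _ (by omega) (by omega)]; exact h.mono k hk l hl hs
  · rw [hne _ (by omega) (by omega)]; exact h.source k (by omega) hkn
  · rw [hne _ (by omega) (by omega)]; exact h.next q hq
  · by_cases has : a = s i
    · subst has
      rw [Function.update_self, Function.update_of_ne (by omega), Function.update_self]
      have := h.next v hvn
      rwa [hts] at this
    · rw [Function.update_of_ne has, hne _ (by omega) (by omega)]
      exact h.head a h₁ ha
  · rw [hne _ (by omega) (by omega)]; exact h.zero x hx
  · rcases (Nat.lt_succ_iff.1 hk).eq_or_lt with rfl | hk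
    · simp
    · rw [hne _ (by omega) (by omega)]
      have := h.lt_ptr k hk
      by_cases hs : s k = s i
      · rw [hs] at this
        rw [hs, Function.update_self]
        omega
      · rwa [Function.update_of_ne hs]
  · have hold : q < p a → ∃ k < i + 1, Function.update (Function.update mem (n + n + s i)
        (mem (n + v))) i v k = q := fun hqa => by
      obtain ⟨k, hk, rfl⟩ := h.used a q hqa hta hqn
      exact ⟨k, by omega, hne _ (by omega) (by omega)⟩
    by_cases has : a = s i
    · subst has
      rw [Function.update_self] at hq
      rcases lt_trichotomy q v with hlt | rfl | hlt
      · refine hold (not_le.1 fun hle => hfirst q hle hlt hta)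
      · exact ⟨i, by omega, Function.update_self ..⟩
      · omega
    · rw [Function.update_of_ne has] at hq
      exact hold hq

/-- The symbol `i` of `s` has no counterpart in `t`: the positions `f 0, …, f (i - 1)` in `t`
include all those of its symbol, and they are matched with smaller positions in `s`. -/
def Unmatched (n : ℕ) (s t : ℕ → ℕ) : Prop :=
  ∃ (i : ℕ) (f : ℕ → ℕ), i < n ∧ (∀ k < i, t (f k) = s k) ∧
    ∀ q < n, t q = s i → ∃ k < i, f k = q

/-- `f` matches the occurrences of every symbol in `s` with those in `t` in order. -/
structure Matched (n : ℕ) (s t f : ℕ → ℕ) : Prop where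
  lt : ∀ k < n, f k < n
  comp : ∀ k < n, t (f k) = s k
  mono : ∀ k < n, ∀ l < k, s l = s k → f l < f k

lemma leads_match {w n σ : ℕ} {s t : ℕ → ℕ} {Q : ℕ → State → Prop}
    (hs : ∀ q < n, 1 ≤ s q ∧ s q ≤ σ) (hw : n + n + σ + n * n + 1 < 2 ^ w)
    (m i : ℕ) (hi : i + m = n)
    (c x₆ x₇ x₈ : ℕ) (mem p : ℕ → ℕ) (hmem : MatchInv n σ s t i mem p)
    (h : ∀ c' x₆ x₇ x₈ f, c' ≤ c + 15 * m + 1 → Matched n s t f →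
      (∀ x, n + n + σ < x → f x = 0) →
      Leads w swapProgram c' ⟨28, regs [n, σ, 1, 0, n + n, n, x₆, x₇, x₈,
        ∑ k ∈ Finset.range n, (f k - k), 0, 0, 0, 0, 0, 0, 0, 0], f⟩ Q)
    (h' : ∀ c' x₅ x₆ x₇ x₈ x₉ mem, c' ≤ c + 15 * m + 1 → Unmatched n s t →
      Leads w swapProgram c' ⟨81, regs [n, σ, 1, 0, n + n, x₅, x₆, x₇, x₈,
        x₉, 0, 0, 0, 0, 0, 0, 0, 0], mem⟩ Q) :
    Leads w swapProgram c ⟨13, regs [n, σ, 1, 0, n + n, i, x₆, x₇, x₈,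
      ∑ k ∈ Finset.range i, (mem k - k), 0, 0, 0, 0, 0, 0, 0, 0], mem⟩ Q := by
  induction m generalizing i c x₆ x₇ x₈ mem p with
  | zero =>
    obtain rfl : i = n := by omega
    exact .jumpEq_pos rfl rfl (h _ _ _ _ _ (by omega) ⟨hmem.lt, hmem.comp, hmem.mono⟩ hmem.zero)
  | succ m ih =>
    have hin : i < n := by omega
    obtain ⟨h₁, hσ⟩ := hs i hin
    have hle := (hmem.head _ h₁ hσ).le
    refine .jumpEq_neg rfl (by simpa using hin.ne) ?_
    refine .load (s i) rfl (by simp) (by simpa using hmem.source i le_rfl hin) (by omega) ?_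
    refine .add rfl (by simp) (by simp; omega) ?_
    refine .load (mem (n + n + s i)) rfl (by simp) (by simp [add_comm]) (by omega) ?_
    obtain hx | ⟨v, hv⟩ : mem (n + n + s i) = 0 ∨ ∃ v, mem (n + n + s i) = v + 1 := by
      cases mem (n + n + s i) <;> simp
    -- The list is exhausted: every occurrence of the symbol in `t` is already matched.
    · refine .jumpEq_pos rfl hx (h' _ _ _ _ _ _ _ (by omega) ?_)
      obtain ⟨-, hfirst⟩ | ⟨q, hq, -⟩ := hmem.head _ h₁ hσ
      · exact ⟨i, mem, hin, hmem.comp, fun q hq hts => hmem.used (s i) q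
          (not_le.1 fun hle => hfirst q hle hq hts) hts hq⟩
      · omega
    · have hinv := hmem.succ hin h₁ hσ hv
      have hvn : v < n := by omega
      have hx₈ := (hmem.next v hvn).le
      rw [hv]
      refine .jumpEq_neg rfl (by simp) ?_
      refine .sub rfl (by simp) (by simp; omega) (by simp) ?_
      refine .add rfl (by simp) (by simp; omega) ?_
      refine .load (mem (n + v)) rfl (by simp) (by simp [add_comm]) (by omega) ?_
      refine .store rfl ?_
      refine .store rfl ?_
      have hsum : ∑ k ∈ Finset.range (i + 1), (Function.update (Function.update mem
          (n + n + s i) (mem (n + v))) i v k - k) =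
          ∑ k ∈ Finset.range i, (mem k - k) + (v - i) := by
        rw [Finset.sum_range_succ, Function.update_self]
        congr 1
        refine Finset.sum_congr rfl fun k hk => ?_
        rw [Finset.mem_range] at hk
        rw [Function.update_of_ne (by omega), Function.update_of_ne (by omega)]
      have hbound : ∑ k ∈ Finset.range i, (mem k - k) ≤ i * n := by
        rw [← Finset.card_range i, ← smul_eq_mul]
        simp only [Finset.card_range]
        refine (Finset.sum_le_card_nsmul _ _ n fun k hk => ?_).trans (by simp)
        have := hmem.lt k (Finset.mem_range.1 hk)
        omega
      have hbound' : i * n ≤ n * n := Nat.mul_le_mul_right n hin.le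
      -- Only positive displacements are accumulated; for `v < i` the truncated difference `v - i`
      -- is `0`.
      rcases lt_or_ge v i with hlt | hge
      · refine .jumpLt_pos rfl (by simpa using hlt) ?_
        refine .add rfl (by simp) (by simp; omega) ?_
        refine .jump rfl ?_
        have := ih (i + 1) (by omega) (c + 1 + 1 + 1 + 1 + 1 + 1 + 1 + 1 + 1 + 1 + 1 + 1 + 1)
          (s i + (n + n)) v (mem (n + v)) _ _ hinv
          (fun c' x₆ x₇ x₈ f hc => h c' x₆ x₇ x₈ f (by omega))
          (fun c' x₅ x₆ x₇ x₈ x₉ f hc => h' c' x₅ x₆ x₇ x₈ x₉ f (by omega))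
        rw [hsum, Nat.sub_eq_zero_of_le hlt.le, add_zero, add_comm (n + n) (s i)] at this
        simpa using this
      · refine .jumpLt_neg rfl (by simpa using hge) ?_
        refine .sub rfl (by simp) (by simp; omega) (by simpa using hge) ?_
        refine .add rfl (by simp) (by simp; omega) ?_
        refine .add rfl (by simp) (by simp; omega) ?_
        refine .jump rfl ?_
        have := ih (i + 1) (by omega) (c + 1 + 1 + 1 + 1 + 1 + 1 + 1 + 1 + 1 + 1 + 1 + 1 + 1 + 1 + 1)
          (v - i) v (mem (n + v)) _ _ hinv
          (fun c' x₆ x₇ x₈ f hc => h c' x₆ x₇ x₈ f (by omega))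
          (fun c' x₅ x₆ x₇ x₈ x₉ f hc => h' c' x₅ x₆ x₇ x₈ x₉ f (by omega))
        rw [hsum, add_comm (n + n) (s i)] at this
        simpa using this

/-! ### Counting the inversions -/

/-- The disjunction on `K` records minimality, which later bounds `K` by a logarithm. -/
lemma leads_levels {w n σ E x₅ x₇ x₈ : ℕ} {mem : ℕ → ℕ} {Q : ℕ → State → Prop}
    (hn : 0 < n) (hE : E ≤ n * n) (hw : n + n * n + n * n < 2 ^ w)
    (c K : ℕ) (hK : K = 0 ∨ n * 2 ^ (K - 1) < E)
    (h : ∀ c' K', c' + 4 * K ≤ c + 4 * K' + 2 → (K' = 0 ∨ n * 2 ^ (K' - 1) < E) →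
      E ≤ n * 2 ^ K' →
      Leads w swapProgram c' ⟨34, regs [n, σ, 1, 0, n + n, x₅, n * 2 ^ K', x₇, x₈,
        E, K', 0, 0, 0, 0, 0, 0, 0], mem⟩ Q) :
    Leads w swapProgram c ⟨29, regs [n, σ, 1, 0, n + n, x₅, n * 2 ^ K, x₇, x₈,
      E, K, 0, 0, 0, 0, 0, 0, 0], mem⟩ Q := by
  induction hm : E - n * 2 ^ K using Nat.strong_induction_on generalizing c K with
  | _ m ih =>
    rcases lt_or_ge (n * 2 ^ K) E with hlt | hge
    · have hpos : 0 < n * 2 ^ K := by positivity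
      have hKn : K < n := by
        have h₁ : n * 2 ^ K < n * n := hlt.trans_le hE
        exact Nat.lt_two_pow_self.trans (Nat.lt_of_mul_lt_mul_left h₁)
      have hstep : n * 2 ^ K + n * 2 ^ K = n * 2 ^ (K + 1) := by ring
      refine .jumpLt_pos rfl (by simpa using hlt) ?_
      refine .add rfl (by simp) (by simp; omega) ?_
      refine .add rfl (by simp) (by simp; omega) ?_
      refine .jump rfl ?_
      have := ih (E - n * 2 ^ (K + 1)) (by omega) (c + 1 + 1 + 1 + 1) (K + 1) (.inr hlt)
        (fun c' K' hc => h c' K' (by omega)) rfl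
      simpa [hstep] using this
    · refine .jumpLt_neg rfl (by simpa using hge) ?_
      refine .jump rfl ?_
      exact h _ _ (by omega) hK hge

/-- The number of the first `i` values of `f` in the `u`-th block of length `2 ^ k`. -/
def blockCount (f : ℕ → ℕ) (i k u : ℕ) : ℕ :=
  ((Finset.range i).filter fun j => f j / 2 ^ k = u).card

/-- The number of the first `i` values of `f` in the first `u` blocks of length `2 ^ k`. -/
def prefixCount (f : ℕ → ℕ) (i k u : ℕ) : ℕ :=
  ((Finset.range i).filter fun j => f j / 2 ^ k < u).card

/-- The number of the first `i` values of `f` that are smaller than `f i` and in the same block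
of length `2 ^ k`. -/
def localCount (f : ℕ → ℕ) (i k : ℕ) : ℕ :=
  ((Finset.range i).filter fun j => f j / 2 ^ k = f i / 2 ^ k ∧ f j < f i).card

/-! ### Identities for block counts -/

lemma blockCount_le (f : ℕ → ℕ) (i k u : ℕ) : blockCount f i k u ≤ i :=
  (Finset.card_filter_le _ _).trans (Finset.card_range i).le

lemma prefixCount_le (f : ℕ → ℕ) (i k u : ℕ) : prefixCount f i k u ≤ i :=
  (Finset.card_filter_le _ _).trans (Finset.card_range i).le

lemma localCount_le (f : ℕ → ℕ) (i k : ℕ) : localCount f i k ≤ i :=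
  (Finset.card_filter_le _ _).trans (Finset.card_range i).le

lemma blockCount_succ (f : ℕ → ℕ) (i k u : ℕ) :
    blockCount f (i + 1) k u = blockCount f i k u + if f i / 2 ^ k = u then 1 else 0 := by
  simp only [blockCount, Finset.range_add_one, Finset.filter_insert]
  split_ifs <;> simp

lemma prefixCount_succ_right (f : ℕ → ℕ) (i k u : ℕ) :
    prefixCount f i k (u + 1) = prefixCount f i k u + blockCount f i k u := by
  rw [prefixCount, prefixCount, blockCount,
    ← Finset.card_union_of_disjoint (Finset.disjoint_filter.2 fun j _ h => h.ne),
    ← Finset.filter_or]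
  exact congrArg _ (Finset.filter_congr fun j _ => Nat.lt_succ_iff_lt_or_eq)

lemma localCount_zero (f : ℕ → ℕ) (i : ℕ) : localCount f i 0 = 0 := by
  simp only [localCount, pow_zero, Nat.div_one, Finset.card_eq_zero, Finset.filter_eq_empty_iff]
  omega

/-- A block of length `2 ^ (k + 1)` has two halves. If `f i` lies in the right one (odd index),
every value in the left half is smaller; otherwise the right half contributes nothing. -/
lemma localCount_succ (f : ℕ → ℕ) (i k : ℕ) :
    localCount f i (k + 1) = localCount f i k +
      if f i / 2 ^ k % 2 = 0 then 0 else blockCount f i k (f i / 2 ^ k - 1) := by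
  have h₁ : ∀ j, f j < f i → f j / 2 ^ k ≤ f i / 2 ^ k := fun j h =>
    Nat.div_le_div_right h.le
  have h₂ : ∀ j, f j / 2 ^ k < f i / 2 ^ k → f j < f i := fun j h => by
    by_contra hle
    exact h.not_ge (Nat.div_le_div_right (not_lt.1 hle))
  simp only [localCount, blockCount, pow_succ, ← Nat.div_div_eq_div_mul]
  split_ifs with h
  · rw [add_zero]
    congr 1
    refine Finset.filter_congr fun j _ => ?_
    have h₁ := h₁ j
    generalize f i / 2 ^ k = x at *
    generalize f j / 2 ^ k = y at *
    constructor <;> rintro ⟨ha, hb⟩ <;> refine ⟨?_, hb⟩ <;> have := h₁ hb <;> omega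
  · rw [← Finset.card_union_of_disjoint, ← Finset.filter_or]
    · congr 1
      refine Finset.filter_congr fun j _ => ?_
      have h₁ := h₁ j
      have h₂ := h₂ j
      generalize f i / 2 ^ k = x at *
      generalize f j / 2 ^ k = y at *
      omega
    · exact Finset.disjoint_filter.2 fun j _ h => by omega

/-- A smaller value lies in an earlier block or in the block of `f i`; by distinctness all others
are larger. So the inversions ending at `i` are obtained from `i` by two subtractions. -/
lemma prefixCount_add_localCount (f : ℕ → ℕ) (i k : ℕ) (hf : ∀ j < i, f j ≠ f i) :
    prefixCount f i k (f i / 2 ^ k) + localCount f i k +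
      ((Finset.range i).filter fun j => f i < f j).card = i := by
  have h₂ : ∀ j, f j / 2 ^ k < f i / 2 ^ k → f j < f i := fun j h => by
    by_contra hle
    exact h.not_ge (Nat.div_le_div_right (not_lt.1 hle))
  have h₁ : ∀ j, f j < f i → f j / 2 ^ k ≤ f i / 2 ^ k := fun j h =>
    Nat.div_le_div_right h.le
  have h₃ : prefixCount f i k (f i / 2 ^ k) + localCount f i k =
      ((Finset.range i).filter fun j => ¬ f i < f j).card := by
    rw [prefixCount, localCount, ← Finset.card_union_of_disjoint, ← Finset.filter_or]
    · congr 1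
      refine Finset.filter_congr fun j hj => ?_
      have h₁ := h₁ j
      have h₂ := h₂ j
      have h₄ := hf j (Finset.mem_range.1 hj)
      omega
    · exact Finset.disjoint_filter.2 fun j _ h => by omega
  rw [h₃, add_comm, Finset.card_filter_add_card_filter_not, Finset.card_range]

lemma inversionSum_le (f : ℕ → ℕ) (i : ℕ) : inversionSum f i ≤ i * i := by
  refine (Finset.sum_le_card_nsmul _ _ i fun j hj => ?_).trans (by simp)
  exact (Finset.card_filter_le _ _).trans (by simpa using (Finset.mem_range.1 hj).le)

/-- The memory of the main loop: `f`, and a tree with levels `0, …, K` starting at `B`, into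
which the first `i` values of `f` have been entered, and the `i`-th one on the levels below
`k`. -/
structure TreeInv (n B K : ℕ) (f : ℕ → ℕ) (i k : ℕ) (mem : ℕ → ℕ) : Prop where
  val : ∀ j < n, mem j = f j
  cell : ∀ l ≤ K, ∀ u < n, mem (B + l * n + u) = blockCount f (if l < k then i + 1 else i) l u

/-- The levels occupy disjoint segments of `n` cells, so only one count changes. -/
lemma TreeInv.succ {n B K : ℕ} {f : ℕ → ℕ} {i k : ℕ} {mem : ℕ → ℕ}
    (h : TreeInv n B K f i k mem) (hB : n ≤ B) (hk : k ≤ K) (hf : f i < n) :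
    TreeInv n B K f i (k + 1) (Function.update mem (B + k * n + f i / 2 ^ k)
      (blockCount f i k (f i / 2 ^ k) + 1)) := by
  have hu : f i / 2 ^ k < n := (Nat.div_le_self _ _).trans_lt hf
  have hu₀ : 0 ≤ f i / 2 ^ k := Nat.zero_le _
  refine ⟨fun j hj => ?_, fun l hl u hun => ?_⟩
  · rw [Function.update_of_ne (by omega), h.val j hj]
  · rcases lt_trichotomy l k with hlk | rfl | hlk
    · have : l * n + n ≤ k * n := by
        rw [← Nat.succ_mul]; exact Nat.mul_le_mul_right n hlk
      rw [Function.update_of_ne (by omega), h.cell l hl u hun, if_pos hlk, if_pos (by omega)]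
    · rw [if_pos (by omega), blockCount_succ]
      by_cases hu' : u = f i / 2 ^ l
      · rw [hu', Function.update_self, if_pos rfl]
      · rw [Function.update_of_ne (by omega), h.cell l hl u hun, if_neg (by omega),
          if_neg (Ne.symm hu'), add_zero]
    · have : k * n + n ≤ l * n := by
        rw [← Nat.succ_mul]; exact Nat.mul_le_mul_right n hlk
      rw [Function.update_of_ne (by omega), h.cell l hl u hun, if_neg (by omega),
        if_neg (by omega)]

lemma TreeInv.next {n B K : ℕ} {f : ℕ → ℕ} {i : ℕ} {mem : ℕ → ℕ}
    (h : TreeInv n B K f i (K + 1) mem) : TreeInv n B K f (i + 1) 0 mem :=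
  ⟨h.val, fun l hl u hu => by
    rw [h.cell l hl u hu, if_pos (by omega), if_neg (by omega)]⟩

/-! ### Climbing the tree and moving the finger -/

lemma leads_climb {w n σ E B K b Z acc i : ℕ} {f : ℕ → ℕ} {Q : ℕ → State → Prop}
    (hB : n ≤ B) (hw : B + (K + 1) * n + n + K < 2 ^ w) (hi : i < n) (hf : f i < n)
    (m k : ℕ) (hk : k + m = K) (c x₁₆ x₁₇ : ℕ) (mem : ℕ → ℕ) (hmem : TreeInv n B K f i k mem)
    (h : ∀ c' x₁₆ x₁₇ mem', c' ≤ c + 14 * m + 1 → TreeInv n B K f i K mem' →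
      Leads w swapProgram c' ⟨56, regs [n, σ, 1, 0, n + n, i, f i / 2 ^ K, B + K * n, 0,
        E, K, B, b, Z, acc, localCount f i K, x₁₆, x₁₇], mem'⟩ Q) :
    Leads w swapProgram c ⟨42, regs [n, σ, 1, 0, n + n, i, f i / 2 ^ k, B + k * n, m,
      E, K, B, b, Z, acc, localCount f i k, x₁₆, x₁₇], mem⟩ Q := by
  induction m generalizing k c x₁₆ x₁₇ mem with
  | zero =>
    obtain rfl : k = K := by omega
    exact .jumpEq_pos rfl rfl (h _ _ _ _ (by omega) hmem)
  | succ m ih =>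
    have hu : f i / 2 ^ k < n := (Nat.div_le_self _ _).trans_lt hf
    have hkn : k * n + n ≤ (K + 1) * n := by
      rw [← Nat.succ_mul]; exact Nat.mul_le_mul_right n (by omega)
    have hcell := hmem.cell k (by omega)
    rw [if_neg (lt_irrefl k)] at hcell
    have hw0 : 0 < w := by
      rcases Nat.eq_zero_or_pos w with rfl | h
      · simp at hw; omega
      · exact h
    have hbc : ∀ u, blockCount f i k u ≤ i := blockCount_le f i k
    have hlc : localCount f i k ≤ i := localCount_le f i k
    have hlc' : localCount f i (k + 1) ≤ i := localCount_le f i (k + 1)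
    have hlcs := localCount_succ f i k
    have hdiv : f i / 2 ^ k / 2 = f i / 2 ^ (k + 1) := by
      rw [Nat.div_div_eq_div_mul, pow_succ]
    have hmul : B + k * n + n = B + (k + 1) * n := by ring
    have hmem' := hmem.succ hB (by omega) hf
    have hu₀ : 0 ≤ f i / 2 ^ k := Nat.zero_le _
    refine .jumpEq_neg rfl (Nat.succ_ne_zero m) ?_
    refine .add rfl (by simp) (by simp; omega) ?_
    refine .and_one rfl (by simp) hw0 rfl ?_
    -- Both parities meet here, after `4` or `7` steps; `7` more complete the `14` per level.
    have tail : ∀ c' x₁₇, c' ≤ c + 7 →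
        Leads w swapProgram c' ⟨49, regs [n, σ, 1, 0, n + n, i, f i / 2 ^ k, B + k * n, m + 1,
          E, K, B, b, Z, acc, localCount f i (k + 1), B + k * n + f i / 2 ^ k, x₁₇], mem⟩ Q := by
      intro c' x₁₇ hc'
      refine .load _ rfl (by simp) (hcell _ hu) (by have := hbc (f i / 2 ^ k); omega) ?_
      refine .add rfl (by simp) (by have := hbc (f i / 2 ^ k); simp; omega) ?_
      refine .store rfl ?_
      refine .shr_one rfl (by simp) (by simp; omega) rfl ?_
      refine .add rfl (by simp) (by simp; omega) ?_
      refine .sub rfl (by simp) (by simp; omega) (by simp) ?_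
      refine .jump rfl ?_
      have := ih (k + 1) (by omega) (c' + 1 + 1 + 1 + 1 + 1 + 1 + 1) (B + k * n + f i / 2 ^ k)
        (blockCount f i k (f i / 2 ^ k) + 1) _ hmem'
        fun c' x₁₆ x₁₇ mem' hc => h c' x₁₆ x₁₇ mem' (by omega)
      simpa [hdiv, hmul] using this
    rcases Nat.mod_two_eq_zero_or_one (f i / 2 ^ k) with hpar | hpar
    · rw [if_pos hpar, add_zero] at hlcs
      refine .jumpEq_pos rfl (by simpa using hpar) ?_
      have := tail (c + 1 + 1 + 1 + 1) (f i / 2 ^ k % 2) (by omega)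
      rw [hlcs] at this
      simpa using this
    · rw [if_neg (by omega)] at hlcs
      refine .jumpEq_neg rfl (by simp [hpar]) ?_
      refine .sub rfl (by simp) (by simp; omega) (by simp; omega) ?_
      refine .load (blockCount f i k (f i / 2 ^ k - 1)) rfl (by simp) ?_
        (by have := hbc (f i / 2 ^ k - 1); omega) ?_
      · have := hcell (f i / 2 ^ k - 1) (by omega)
        rwa [← Nat.add_sub_assoc (by omega)] at this
      refine .add rfl (by simp)
        (by have := hbc (f i / 2 ^ k - 1); simp; omega) ?_
      have := tail (c + 1 + 1 + 1 + 1 + 1 + 1 + 1) (blockCount f i k (f i / 2 ^ k - 1)) (by omega)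
      rw [hlcs] at this
      simpa using this

lemma leads_finger_up {w n σ E B K acc i q x₅ x₁₆ u : ℕ} {f mem : ℕ → ℕ}
    {Q : ℕ → State → Prop} (hw : B + (K + 1) * n + n + K < 2 ^ w) (hi : i ≤ n) (hu : u < n)
    (hmem : ∀ u < n, mem (B + K * n + u) = blockCount f i K u)
    (m b : ℕ) (hb : b + m = u) (c x₁₇ : ℕ)
    (h : ∀ c' x₁₇, c' ≤ c + 6 * m + 3 →
      Leads w swapProgram c' ⟨69, regs [n, σ, 1, 0, n + n, x₅, u, B + K * n, 0,
        E, K, B, u, prefixCount f i K u, acc, q, x₁₆, x₁₇], mem⟩ Q) :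
    Leads w swapProgram c ⟨56, regs [n, σ, 1, 0, n + n, x₅, u, B + K * n, 0,
      E, K, B, b, prefixCount f i K b, acc, q, x₁₆, x₁₇], mem⟩ Q := by
  induction m generalizing b c x₁₇ with
  | zero =>
    obtain rfl : b = u := by omega
    exact .jumpLt_neg rfl le_rfl (.jumpLt_neg rfl le_rfl (.jump rfl (h _ _ (by omega))))
  | succ m ih =>
    have hKn : K * n + n = (K + 1) * n := by ring
    have h₁ := prefixCount_le f i K (b + 1)
    have h₂ := prefixCount_succ_right f i K b
    refine .jumpLt_pos rfl (by simp; omega) ?_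
    refine .add rfl (by simp) (by simp; omega) ?_
    refine .load _ rfl (by simp) (hmem b (by omega)) (by omega) ?_
    refine .add rfl (by simp) (by simp; omega) ?_
    refine .add rfl (by simp) (by simp; omega) ?_
    refine .jump rfl ?_
    have := ih (b + 1) (by omega) (c + 1 + 1 + 1 + 1 + 1 + 1) (blockCount f i K b)
      fun c' x₁₇ hc => h c' x₁₇ (by omega)
    rw [h₂] at this
    simpa using this

lemma leads_finger_down {w n σ E B K acc i q x₅ x₁₆ u : ℕ} {f mem : ℕ → ℕ}
    {Q : ℕ → State → Prop} (hw : B + (K + 1) * n + n + K < 2 ^ w) (hi : i ≤ n)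
    (hmem : ∀ u < n, mem (B + K * n + u) = blockCount f i K u)
    (m b : ℕ) (hb : b = u + m) (hbn : b ≤ n) (c x₁₇ : ℕ)
    (h : ∀ c' x₁₇, c' ≤ c + 7 * m + 3 →
      Leads w swapProgram c' ⟨69, regs [n, σ, 1, 0, n + n, x₅, u, B + K * n, 0,
        E, K, B, u, prefixCount f i K u, acc, q, x₁₆, x₁₇], mem⟩ Q) :
    Leads w swapProgram c ⟨56, regs [n, σ, 1, 0, n + n, x₅, u, B + K * n, 0,
      E, K, B, b, prefixCount f i K b, acc, q, x₁₆, x₁₇], mem⟩ Q := by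
  induction m generalizing b c x₁₇ with
  | zero =>
    obtain rfl : b = u := by omega
    exact .jumpLt_neg rfl le_rfl (.jumpLt_neg rfl le_rfl (.jump rfl (h _ _ (by omega))))
  | succ m ih =>
    obtain ⟨b, rfl⟩ : ∃ b', b = b' + 1 := ⟨b - 1, by omega⟩
    have hKn : K * n + n = (K + 1) * n := by ring
    have h₁ := prefixCount_le f i K (b + 1)
    have h₂ := prefixCount_succ_right f i K b
    refine .jumpLt_neg rfl (by simp; omega) ?_
    refine .jumpLt_pos rfl (by simp; omega) ?_
    refine .sub rfl (by simp) (by simp; omega) (by simp) ?_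
    refine .add rfl (by simp) (by simp; omega) ?_
    refine .load (blockCount f i K b) rfl (by simp) (by simpa using hmem b (by omega))
      (by omega) ?_
    refine .sub rfl (by simp) (by simp; omega) (by simp; omega) ?_
    refine .jump rfl ?_
    have := ih b (by omega) (by omega) (c + 1 + 1 + 1 + 1 + 1 + 1 + 1) (blockCount f i K b)
      fun c' x₁₇ hc => h c' x₁₇ (by omega)
    have h₃ : prefixCount f i K (b + 1) - blockCount f i K b = prefixCount f i K b := by omega
    simpa [h₃] using this

/-- The block on the top level `K` at which the finger stands before the `i`-th round. -/
def finger (f : ℕ → ℕ) (K : ℕ) : ℕ → ℕ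
  | 0 => 0
  | i + 1 => f i / 2 ^ K

/-- The number of blocks by which the finger moves in the `i`-th round. -/
def fingerMove (f : ℕ → ℕ) (K i : ℕ) : ℕ :=
  (finger f K (i + 1) - finger f K i) + (finger f K i - finger f K (i + 1))

lemma leads_main {w n σ E B K : ℕ} {f : ℕ → ℕ} {Q : ℕ → State → Prop}
    (hB : n ≤ B) (hw : B + (K + 1) * n + n + K + n * n < 2 ^ w)
    (hf : ∀ i < n, f i < n) (hinj : ∀ i < n, ∀ j < i, f j ≠ f i)
    (m i : ℕ) (hi : i + m = n) (c x₆ x₇ x₈ x₁₅ x₁₆ x₁₇ : ℕ) (mem : ℕ → ℕ)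
    (hmem : TreeInv n B K f i 0 mem)
    (h : ∀ c' x₆ x₇ x₈ x₁₂ x₁₃ x₁₅ x₁₆ x₁₇ mem',
      c' ≤ c + ∑ j ∈ Finset.Ico i n, (14 * K + 18 + 7 * fingerMove f K j) + 1 →
      Leads w swapProgram c' ⟨78, regs [n, σ, 1, 0, n + n, n, x₆, x₇, x₈,
        E, K, B, x₁₂, x₁₃, inversionSum f n, x₁₅, x₁₆, x₁₇], mem'⟩ Q) :
    Leads w swapProgram c ⟨37, regs [n, σ, 1, 0, n + n, i, x₆, x₇, x₈,
      E, K, B, finger f K i, prefixCount f i K (finger f K i), inversionSum f i,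
      x₁₅, x₁₆, x₁₇], mem⟩ Q := by
  induction m generalizing i c x₆ x₇ x₈ x₁₅ x₁₆ x₁₇ mem with
  | zero =>
    obtain rfl : i = n := by omega
    exact .jumpEq_pos rfl rfl (h _ _ _ _ _ _ _ _ _ _ (by simp))
  | succ m ih =>
    have hin : i < n := by omega
    have hfi := hf i hin
    have hKn : (K + 1) * n = K * n + n := by ring
    rw [Finset.sum_eq_sum_Ico_succ_bot hin] at h
    have hu : f i / 2 ^ K < n := (Nat.div_le_self _ _).trans_lt hfi
    have hfin : finger f K i ≤ n := by
      rcases i with _ | i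
      · exact Nat.zero_le _
      · exact (Nat.div_le_self _ _).trans (hf i (by omega)).le
    have hmove : fingerMove f K i =
      (f i / 2 ^ K - finger f K i) + (finger f K i - f i / 2 ^ K) := rfl
    refine .jumpEq_neg rfl (by simpa using hin.ne) ?_
    refine .load (f i) rfl (by simp) (by simpa using hmem.val i hin) (by omega) ?_
    refine .move rfl (by simp) (by simp; omega) ?_
    refine .move rfl (by simp) (by simp; omega) ?_
    refine .const rfl (by simp) (by omega) ?_
    have hclimb := leads_climb (w := w) (n := n) (σ := σ) (E := E) (b := finger f K i)
      (Z := prefixCount f i K (finger f K i)) (acc := inversionSum f i) (Q := Q) hB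
      (by omega) hin hfi K 0 (by omega) (c + 1 + 1 + 1 + 1 + 1) x₁₆ x₁₇ mem hmem ?_
    · simpa [localCount_zero] using hclimb
    intro c₁ x₁₆ x₁₇ mem₁ hc₁ hmem₁
    have hcell := hmem₁.cell K le_rfl
    rw [if_neg (lt_irrefl K)] at hcell
    have tail : ∀ c' x₁₇, c' ≤ c₁ + 7 * fingerMove f K i + 3 →
        Leads w swapProgram c' ⟨69, regs [n, σ, 1, 0, n + n, i, f i / 2 ^ K, B + K * n, 0,
          E, K, B, f i / 2 ^ K, prefixCount f i K (f i / 2 ^ K), inversionSum f i,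
          localCount f i K, x₁₆, x₁₇], mem₁⟩ Q := by
      intro c' x₁₇ hc'
      have hbc := blockCount_le f i K (f i / 2 ^ K)
      have hsum := prefixCount_add_localCount f i K (hinj i hin)
      have hinv := inversionSum_le f i
      have hii : i * i ≤ n * n := Nat.mul_le_mul hin.le hin.le
      have hinv' : inversionSum f (i + 1) = inversionSum f i + i -
          prefixCount f i K (f i / 2 ^ K) - localCount f i K := by
        rw [inversionSum, Finset.sum_range_succ, ← inversionSum]
        omega
      -- The new value lies in the block of the finger itself, so the prefix sum before that block
      -- stays valid for the next round.
      have hpre : prefixCount f (i + 1) K (f i / 2 ^ K) = prefixCount f i K (f i / 2 ^ K) := by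
        simp [prefixCount, Finset.range_add_one, Finset.filter_insert]
      refine .add rfl (by simp) (by simp; omega) ?_
      refine .load (blockCount f i K (f i / 2 ^ K)) rfl (by simp) (hcell _ hu) (by omega) ?_
      refine .add rfl (by simp) (by simp; omega) ?_
      refine .store rfl ?_
      refine .add rfl (by simp) (by simp; omega) ?_
      refine .sub rfl (by simp) (by simp; omega) (by simp; omega) ?_
      refine .sub rfl (by simp) (by simp; omega) (by simp; omega) ?_
      refine .add rfl (by simp) (by simp; omega) ?_
      refine .jump rfl ?_
      have := ih (i + 1) (by omega) (c' + 1 + 1 + 1 + 1 + 1 + 1 + 1 + 1 + 1) (f i / 2 ^ K)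
        (B + K * n) 0 (localCount f i K) (B + K * n + f i / 2 ^ K)
        (blockCount f i K (f i / 2 ^ K) + 1) _ (hmem₁.succ hB le_rfl hfi).next
        fun c' x₆ x₇ x₈ x₁₂ x₁₃ x₁₅ x₁₆ x₁₇ mem' hc =>
          h c' x₆ x₇ x₈ x₁₂ x₁₃ x₁₅ x₁₆ x₁₇ mem' (by omega)
      simpa [finger, hpre, hinv'] using this
    rcases le_total (finger f K i) (f i / 2 ^ K) with hle | hle
    · exact leads_finger_up (by omega) hin.le hu hcell (f i / 2 ^ K - finger f K i) _ (by omega)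
        _ _ fun c' x₁₇ hc => tail c' x₁₇ (by omega)
    · exact leads_finger_down (by omega) hin.le hcell (finger f K i - f i / 2 ^ K) _ (by omega)
        hfin _ _ fun c' x₁₇ hc => tail c' x₁₇ (by omega)

/-! ### Correctness and running time -/

/-- The symbols of a string as natural numbers, as they are stored in the memory. -/
def symbol {n σ : ℕ} (S : Fin n → Fin σ) (i : ℕ) : ℕ :=
  if h : i < n then (S ⟨i, h⟩).val + 1 else 0

lemma symbol_val {n σ : ℕ} (S : Fin n → Fin σ) (i : Fin n) : symbol S i = (S i).val + 1 := by
  simp [symbol]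

lemma symbol_mem {n σ : ℕ} (S : Fin n → Fin σ) (i : ℕ) (hi : i < n) :
    1 ≤ symbol S i ∧ symbol S i ≤ σ := by
  have := (S ⟨i, hi⟩).isLt
  simp only [symbol, hi, dite_true]
  omega

/-- Pigeonhole: a bijection would send all positions of the symbol `S i` into the `f`-images of
those before `i`, which are fewer since `i` itself is missing. -/
lemma Unmatched.swapEditDist_eq_top {n σ : ℕ} {S T : Fin n → Fin σ}
    (h : Unmatched n (symbol S) (symbol T)) : swapEditDist S T = ⊤ := by
  refine _root_.swapEditDist_eq_top fun π hπ => ?_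
  obtain ⟨i, f, hi, hcomp, hsurj⟩ := h
  have hπ' : ∀ k : Fin n, symbol T (π k) = symbol S k := fun k => by
    rw [symbol_val, symbol_val, hπ]
  set C := (Finset.range i).filter fun k => symbol S k = symbol S i
  set A : Finset (Fin n) := {k | symbol S k = symbol S i}
  have h₁ : A.card ≤ (C.image f).card := by
    refine Finset.card_le_card_of_injOn (fun k => (π k).val) (fun k hk => ?_)
      fun k _ l _ hkl => π.injective (Fin.ext hkl)
    have hk : symbol S k = symbol S i := by simpa [A] using hk
    have hT : symbol T (π k) = symbol S i := by rw [hπ', hk]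
    obtain ⟨l, hl, hfl⟩ := hsurj _ (π k).isLt hT
    refine Finset.mem_coe.2 (Finset.mem_image.2 ⟨l, ?_, hfl⟩)
    rw [Finset.mem_filter, Finset.mem_range, ← hcomp l hl, hfl]
    exact ⟨hl, hT⟩
  have h₂ : C ⊂ A.map Fin.valEmbedding := by
    refine Finset.ssubset_iff_subset_ne.2 ⟨fun k hk => ?_, fun heq => ?_⟩
    · rw [Finset.mem_filter, Finset.mem_range] at hk
      exact Finset.mem_map.2 ⟨⟨k, by omega⟩, by simpa [A] using hk.2, rfl⟩
    · have : i ∈ A.map Fin.valEmbedding := Finset.mem_map.2 ⟨⟨i, hi⟩, by simp [A], rfl⟩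
      rw [← heq, Finset.mem_filter, Finset.mem_range] at this
      exact this.1.false
  have h₃ := Finset.card_lt_card h₂
  rw [Finset.card_map] at h₃
  exact (h₁.trans Finset.card_image_le).not_gt h₃

/-- Positions with a common image carry the same symbol, so strict monotonicity on each symbol gives
injectivity. -/
lemma Matched.exists_perm {n σ : ℕ} {S T : Fin n → Fin σ} {f : ℕ → ℕ}
    (h : Matched n (symbol S) (symbol T) f) :
    ∃ π : Equiv.Perm (Fin n), (∀ i : Fin n, f i = π i) ∧ IsStableMatching S T π := by
  have hlt : ∀ k < n, ∀ l < k, f l ≠ f k := fun k hk l hl he => by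
    have := h.mono k hk l hl (by rw [← h.comp k hk, ← h.comp l (by omega), he])
    omega
  have hinj : Function.Injective fun i : Fin n => (⟨f i, h.lt i i.isLt⟩ : Fin n) := by
    intro i j hij
    simp only [Fin.mk.injEq] at hij
    rcases lt_trichotomy i j with hlt' | rfl | hlt'
    · exact absurd hij (hlt j j.isLt i hlt')
    · rfl
    · exact absurd hij.symm (hlt i i.isLt j hlt')
  refine ⟨Equiv.ofBijective _ (Finite.injective_iff_bijective.1 hinj), fun i => rfl,
    fun i => ?_, fun i j hij hS => ?_⟩
  · have := h.comp i i.isLt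
    rw [symbol_val] at this
    have hT := symbol_val T ⟨f i, h.lt i i.isLt⟩
    simp only at hT
    rw [Equiv.ofBijective_apply, Fin.ext_iff]
    omega
  · exact h.mono j j.isLt i hij (by rw [symbol_val, symbol_val, hS])

lemma sum_fingerMove_le {n K : ℕ} (f : ℕ → ℕ) (π : Equiv.Perm (Fin n))
    (hf : ∀ i : Fin n, f i = π i) (hE : ∑ k ∈ Finset.range n, (f k - k) ≤ n * 2 ^ K) :
    ∑ j ∈ Finset.range n, fingerMove f K j ≤ 6 * n := by
  have hsum : ∑ k ∈ Finset.range n, f k = ∑ k ∈ Finset.range n, k := by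
    rw [Finset.sum_range, Finset.sum_range]
    simp only [hf]
    exact Equiv.sum_comp π fun i => i.val
  -- Positive and negative displacements of a permutation balance.
  have hE' : ∑ k ∈ Finset.range n, (k - f k) = ∑ k ∈ Finset.range n, (f k - k) := by
    have : ∑ k ∈ Finset.range n, ((k - f k) + f k) = ∑ k ∈ Finset.range n, ((f k - k) + k) :=
      Finset.sum_congr rfl fun k _ => by omega
    rw [Finset.sum_add_distrib, Finset.sum_add_distrib] at this
    omega
  have hpos : 0 < 2 ^ K := by positivity
  have hdist : ∀ x y, (x / 2 ^ K - y / 2 ^ K) * 2 ^ K ≤ (x - y) + 2 ^ K := fun x y => by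
    rw [Nat.sub_mul]
    have h₁ := Nat.div_mul_le_self x (2 ^ K)
    have h₂ := Nat.lt_div_mul_add (a := y) hpos
    omega
  -- Each displacement is charged by two consecutive moves; the extra term on the left reserves the
  -- last one for the next move. Per round, one `2 ^ K` pays for rounding to blocks and one for the
  -- shift from `m` to `m + 1`.
  have key : ∀ m, (∑ j ∈ Finset.range m, fingerMove f K j) * 2 ^ K +
      (match m with | 0 => 0 | m + 1 => (f m - m) + (m - f m)) ≤
      2 * ∑ j ∈ Finset.range m, ((f j - j) + (j - f j)) + 2 * m * 2 ^ K := by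
    intro m
    induction m with
    | zero => simp
    | succ m ih =>
      rw [Finset.sum_range_succ, Finset.sum_range_succ, add_mul, mul_add, mul_add 2 m 1, add_mul]
      rcases m with _ | m
      · have h := hdist (f 0) 0
        simp only [fingerMove, finger, Nat.zero_div, Nat.zero_sub, Nat.sub_zero, add_zero] at h ⊢
        simp
        omega
      · have h₁ := hdist (f (m + 1)) (f m)
        have h₂ := hdist (f m) (f (m + 1))
        have h₃ : f m / 2 ^ K ≤ f (m + 1) / 2 ^ K ∨ f (m + 1) / 2 ^ K ≤ f m / 2 ^ K :=
          le_total _ _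
        have h₄ : fingerMove f K (m + 1) * 2 ^ K ≤
            (f (m + 1) - f m) + (f m - f (m + 1)) + 2 ^ K := by
          simp only [fingerMove, finger]
          rcases h₃ with h₃ | h₃ <;> rw [Nat.sub_eq_zero_of_le h₃]
          · rw [add_zero]; omega
          · rw [zero_add]; omega
        dsimp only at ih ⊢
        omega
  have h := key n
  rw [Finset.sum_add_distrib, hE'] at h
  refine Nat.le_of_mul_le_mul_right (c := 2 ^ K) ?_ hpos
  -- The `4` is twice the absolute displacement sum `2 * E`, with `E ≤ n * 2 ^ K`.
  have : 6 * n * 2 ^ K = 4 * (n * 2 ^ K) + 2 * n * 2 ^ K := by ring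
  omega

lemma inputState_listInv {n σ : ℕ} (S T : Fin n → Fin σ) :
    ListInv n σ (symbol S) (symbol T) n (inputState S T).mem where
  source i hi := by simp [inputState, symbol, hi]
  target q hq := by simp [inputState, symbol, hq]
  next q h₁ h₂ := by omega
  head a _ _ := .inl ⟨by
    simp only [inputState]
    rw [dif_neg (by omega), dif_neg (by omega)], fun q h₁ h₂ => by omega⟩
  zero x hx := by
    simp only [inputState]
    rw [dif_neg (by omega), dif_neg (by omega)]

lemma level_cost_le_swapTimeBound {n σ d K : ℕ} (hn : 0 < n)
    (hK : K = 0 ∨ n * 2 ^ (K - 1) < d) :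
    (n * (100 + 18 * K) : ℝ) ≤ 118 * swapTimeBound n σ d := by
  have hn' : (0 : ℝ) < n := by exact_mod_cast hn
  set x := max 0 (Real.logb 2 ((d : ℝ) / n)) with hx
  have hx₀ : 0 ≤ x := le_max_left _ _
  have hKx : (K : ℝ) ≤ 1 + x := by
    rcases Nat.eq_zero_or_pos K with rfl | hpos
    · push_cast; linarith
    · obtain hK | hK := hK
      · omega
      have h₁ : (2 : ℝ) ^ (K - 1) ≤ (d : ℝ) / n := by
        rw [le_div_iff₀ hn', mul_comm]
        exact_mod_cast hK.le
      have h₂ : ((K - 1 : ℕ) : ℝ) ≤ Real.logb 2 ((d : ℝ) / n) := by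
        have hd : (0 : ℝ) < (d : ℝ) / n := lt_of_lt_of_le (by positivity) h₁
        rw [Real.le_logb_iff_rpow_le (by norm_num) hd, Real.rpow_natCast]
        exact h₁
      rw [Nat.cast_sub hpos, Nat.cast_one] at h₂
      have := h₂.trans (le_max_right 0 _)
      linarith
  -- By `K ≤ 1 + x`, where `118 = 100 + 18`.
  have h₁ : (n * (100 + 18 * K) : ℝ) ≤ 118 * (n * (1 + x)) := by nlinarith
  have h₂ : (n * (1 + x) : ℝ) ≤ swapTimeBound n σ d := by
    rw [swapTimeBound, ← hx]
    exact le_mul_of_one_le_right (by positivity) (le_max_left _ _)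
  linarith

/-- What has to hold when the program halts at time `c` in the state `s`. -/
def Correct {n σ : ℕ} (S T : Fin n → Fin σ) (c : ℕ) (s : State) : Prop :=
  swapProgram.length ≤ s.pc ∧ s.output = swapEditDist S T ∧
    (∀ d : ℕ, swapEditDist S T = d → (c : ℝ) ≤ 118 * swapTimeBound n σ d) ∧
    (swapEditDist S T = ⊤ → (c : ℝ) ≤ 118 * (n + σ))

lemma leads_of_unmatched {n σ w : ℕ} {S T : Fin n → Fin σ} (hn : 0 < n)
    (hU : Unmatched n (symbol S) (symbol T)) (c : ℕ) (hc : c ≤ 25 * n + 5) {l : List ℕ}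
    (hl : l.length = 18) (mem : ℕ → ℕ) :
    Leads w swapProgram c ⟨81, regs l, mem⟩ (Correct S T) := by
  refine .const rfl (by omega) (by positivity) (.done ⟨by simp [swapProgram], ?_, ?_, ?_⟩)
  · rw [hU.swapEditDist_eq_top]
    refine if_pos ?_
    simp [regs, hl]
  · intro d hd
    simp [hU.swapEditDist_eq_top] at hd
  · intro _
    have : c + 1 ≤ 118 * (n + σ) := by omega
    exact_mod_cast this

lemma leads_of_matched {n σ w : ℕ} {S T : Fin n → Fin σ} (hn : 0 < n)
    (hw : 2 * (n * n) + 6 * n + σ + 1 < 2 ^ w) {f : ℕ → ℕ}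
    (hM : Matched n (symbol S) (symbol T) f) (hzero : ∀ x, n + n + σ < x → f x = 0)
    (c x₆ x₇ x₈ : ℕ) (hc : c ≤ 25 * n + 5) :
    Leads w swapProgram c ⟨28, regs [n, σ, 1, 0, n + n, n, x₆, x₇, x₈,
        ∑ k ∈ Finset.range n, (f k - k), 0, 0, 0, 0, 0, 0, 0, 0], f⟩ (Correct S T) := by
  obtain ⟨π, hπ, hstable⟩ := hM.exists_perm
  have hdist := swapEditDist_eq_card_inversions hstable
  have hE : ∑ k ∈ Finset.range n, (f k - k) ≤ (inversions π).card := by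
    rw [Finset.sum_range]
    simp only [hπ]
    exact sum_displacement_le_card_inversions π
  rw [card_inversions_eq_inversionSum π f hπ] at hdist hE
  have hEn := hE.trans (inversionSum_le f n)
  set E := ∑ k ∈ Finset.range n, (f k - k) with hEdef
  refine .move rfl (by simp) (by simp; omega) ?_
  have hlevels := leads_levels (w := w) (σ := σ) (E := E) (x₅ := n) (x₇ := x₇) (x₈ := x₈)
    (mem := f) (Q := Correct S T) hn hEn (by omega) (c + 1) 0 (.inl rfl) ?_
  · simpa using hlevels
  intro c₁ K hc₁ hK hEK
  have hKn : K ≤ n := by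
    rcases hK with rfl | hK
    · exact Nat.zero_le _
    · have := Nat.lt_of_mul_lt_mul_left (hK.trans_le hEn)
      have := (Nat.lt_two_pow_self (n := K - 1))
      omega
  have hKn' : (K + 1) * n ≤ (n + 1) * n := Nat.mul_le_mul_right n (by omega)
  rw [add_mul n] at hKn'
  refine .add rfl (by simp) (by simp; omega) ?_
  refine .add rfl (by simp) (by simp; omega) ?_
  refine .const rfl (by simp) (by omega) ?_
  have hinj : ∀ i < n, ∀ j < i, f j ≠ f i := fun i hi j hj he => by
    have := hM.mono i hi j hj (by rw [← hM.comp i hi, ← hM.comp j (by omega), he])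
    omega
  -- The tree starts behind the table of list heads, where memory is still zero, so it needs no
  -- initialisation.
  have htree : TreeInv n (n + n + σ + 1) K f 0 0 f := by
    refine ⟨fun _ _ => rfl, fun l _ u _ => ?_⟩
    rw [hzero _ (by have := Nat.zero_le (l * n); omega), if_neg (by omega)]
    simp [blockCount]
  have hmain := leads_main (w := w) (σ := σ) (E := E) (Q := Correct S T)
    (by omega) (by omega) hM.lt hinj n 0 (by omega) (c₁ + 1 + 1 + 1) (n * 2 ^ K) x₇ x₈ 0 0 0 f
    htree ?_
  · simpa [finger, prefixCount, inversionSum] using hmain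
  intro c₂ x₆ x₇ x₈ x₁₂ x₁₃ x₁₅ x₁₆ x₁₇ mem hc₂
  have hinv := inversionSum_le f n
  refine .move rfl (by simp) (by simp; omega) ?_
  refine .const rfl (by simp) (by omega) ?_
  refine .jump rfl ?_
  refine .done ⟨by simp [swapProgram], ?_, fun d hd => ?_, fun htop => ?_⟩
  · rw [hdist]
    exact if_neg one_ne_zero
  · have hd : inversionSum f n = d := by exact_mod_cast hdist.symm.trans hd
    subst hd
    refine le_trans ?_ (level_cost_le_swapTimeBound hn
      (hK.imp_right fun h => h.trans_le hE))
    have hfm := sum_fingerMove_le f π hπ hEK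
    rw [← Finset.range_eq_Ico, Finset.sum_add_distrib, Finset.sum_const, Finset.card_range,
      ← Finset.mul_sum, smul_eq_mul, mul_add, mul_left_comm] at hc₂
    have hKK : K ≤ n * K := Nat.le_mul_of_pos_left K hn
    -- Matching, rounds and finger cost `25 + 18 + 7 * 6 = 85` per position, and `15` single steps
    -- remain. The levels cost `14 * K` per position and `4 * K` once.
    have : c₂ + 1 + 1 + 1 ≤ n * (100 + 18 * K) := by
      rw [mul_add, mul_left_comm]
      omega
    exact_mod_cast this
  · rw [hdist] at htop
    simp at htop

lemma leads_correct {n σ w : ℕ} (S T : Fin n → Fin σ) (hn : 0 < n)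
    (hw : 2 * (n * n) + 6 * n + σ + 1 < 2 ^ w) :
    Leads w swapProgram 0 (inputState S T) (Correct S T) := by
  rw [inputState_eq]
  refine .const rfl (by simp) (by omega) ?_
  refine .add rfl (by simp) (by simp; omega) ?_
  refine .move rfl (by simp) (by simp; omega) ?_
  refine leads_lists (symbol_mem T) (by omega) n le_rfl 3 0 0 0 _ (inputState_listInv S T)
    fun c₁ x₆ x₇ x₈ mem hc₁ hmem => ?_
  refine leads_match (symbol_mem S) (by omega) n 0 (by omega) c₁ x₆ x₇ x₈ mem 0 hmem.matchInv
    (fun c₂ x₆ x₇ x₈ f hc₂ hM hz => ?_) (fun c₂ x₅ x₆ x₇ x₈ x₉ mem hc₂ hU => ?_)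
  · exact leads_of_matched hn hw hM hz c₂ _ _ _ (by omega)
  · exact leads_of_unmatched hn hU c₂ (by omega) rfl mem

end WordRAM

theorem mainTheorem6 :
    ∃ (P : List WordRAM.Instr) (κ : ℕ) (C : ℝ),
      ∀ (n σ w : ℕ) (S T : Fin n → Fin σ), 0 < n → (n + σ) ^ κ ≤ 2 ^ w →
        ∃ (t : ℕ) (s : WordRAM.State),
          WordRAM.HaltsIn w P (WordRAM.inputState S T) t s ∧
          s.output = swapEditDist S T ∧
          (∀ d : ℕ, swapEditDist S T = d → (t : ℝ) ≤ C * swapTimeBound n σ d) ∧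
          (swapEditDist S T = ⊤ → (t : ℝ) ≤ C * (n + σ)) := by
  -- Addresses and counts are quadratic in `n` and linear in `σ`. As `n + σ ≥ 2`, the exponent `5`
  -- supplies a factor `8` on top of `(n + σ) ^ 2`, which absorbs the constants.
  refine ⟨WordRAM.swapProgram, 5, 118, fun n σ w S T hn hw => ?_⟩
  have hσ : 0 < σ := (S ⟨0, hn⟩).pos
  have hw' : 2 * (n * n) + 6 * n + σ + 1 < 2 ^ w := by
    refine lt_of_lt_of_le ?_ hw
    have h₁ : 2 ^ 3 ≤ (n + σ) ^ 3 := Nat.pow_le_pow_left (by omega) 3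
    have h₂ : (n + σ) ^ 5 = (n + σ) ^ 3 * (n + σ) ^ 2 := by ring
    rw [h₂]
    refine lt_of_lt_of_le ?_ (Nat.mul_le_mul_right _ h₁)
    nlinarith [Nat.mul_le_mul hn hσ, Nat.mul_le_mul hn (le_refl n)]
  obtain ⟨t, ⟨hlen, hout, hfin, htop⟩, hpc⟩ := WordRAM.leads_correct S T hn hw'
  rw [zero_add] at hfin htop
  exact ⟨t, _, ⟨rfl, hlen, hpc⟩, hout, hfin, htop⟩
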